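/- Setting. Let $\mathcal V$ be a finite set of agents. Agent $j$ has a state space $\mathcal S_j$ and an action space $\mathcal A_j$. Directed graphs $\mathcal E_S,\mathcal E_O,\mathcal E_R\subseteq\mathcal V\times\mathcal V$ (state, observation and reward graph) define the index sets $\mathcal I_X^j=\{k:(k,j)\in\mathcal E_X\}\cup\{j\}$, $X\in\{S,O,R\}$. Given the global state $s=(s_j)_j$ and action $a=(a_j)_j$, the next states of the agents are independent, that of agent $j$ having law $\mathcal P_j(\cdot\mid s_{\mathcal I_S^j},a_{\mathcal I_S^j})$; agent $j$ receives the reward $r_j(s_{\mathcal I_R^j},a_{\mathcal I_R^j})$ and observes $o_j=s_{\mathcal I_O^j}$; the discount factor is $\gamma\in[0,1)$. The agents act independently, agent $j$ by a local policy $\pi_{\theta_j}(\cdot\mid o_j)$ with parameter $\theta_j\in\mathbb R^{d_j}$; $\pi$ is the resulting global policy. Put $$Q_j(s,a)=\mathbb E\Big[\sum_{t\ge0}\gamma^t r_j(t)\,\Big|\,s(0)=s,\ a(0)=a\Big],\quad V(s)=\mathbb E\Big[\sum_{t\ge0}\gamma^t\sum_j r_j(t)\,\Big|\,s(0)=s\Big],\quad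 J(\theta)=\mathbb E_{s\sim\mathcal D}V(s),$$ where $r_j(t)=r_j(s_{\mathcal I_R^j}(t),a_{\mathcal I_R^j}(t))$ and $\mathcal D$ is the distribution of the initial state, and let $d^\pi=(1-\gamma)\sum_{t\ge0}\gamma^t\,\mathrm{Law}(s(t))$ with $s(0)\sim\mathcal D$ be the (normalized) discounted state visitation distribution. Let $U_j^{(0)}=\bigcup_{k\in\mathcal I_R^j}\mathcal I_O^k$, $U_j^{(n+1)}=U_j^{(0)}\cup\bigcup_{l\in U_j^{(n)}}\bigcup_{k\in\mathcal I_S^l}\mathcal I_O^k$, and let $\mathcal I_Q^j=\bigcup_{n\ge 0} U_j^{(n)}$ be the value dependency set of $j$. For an agent $i$ let $\mathcal I_{GD}^i=\{j: i\in\mathcal I_Q^j\}\cup\{i\}$ and $\mathcal I_{\widehat Q}^i=\bigcup_{j\in\mathcal I_{GD}^i}\mathcal I_Q^j$; then $i\in\mathcal I_{\widehat Q}^i$ and $\mathcal I_O^j\subseteq\mathcal I_{\widehat Q}^i$ for all $j\in\mathcal I_{\widehat Q}^i$. Theorem (multi-agent policy gradient theorem). Fix $\theta$ and an agent $i$. In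 each of the cases (a) and (b) below, every $Q_j(s,a)$ depends only on $(s_{\mathcal I_Q^j},a_{\mathcal I_Q^j})$, so that $$\widehat Q_i(s_{\mathcal I_{\widehat Q}^i},a_{\mathcal I_{\widehat Q}^i})=\sum_{j\in\mathcal I_{GD}^i}Q_j(s_{\mathcal I_Q^j},a_{\mathcal I_Q^j})$$ is a function of the states and actions of the agents in $\mathcal I_{\widehat Q}^i$ alone; $J$ is differentiable with respect to $\theta_i$ at $\theta$; and the following holds, the integrand being integrable. (a) Deterministic policies $a_j=\pi_{\theta_j}(o_j)$. Let each $\mathcal S_j$ be a compact metric space and $\mathcal A_j=\mathbb R^{m_j}$; let $\mathcal P_j$ have a density $p_j\ge 0$ with respect to a finite Borel measure on $\mathcal S_j$; and let $p_j$, $r_j$ and $\pi_{\theta_j}(o_j)$ be jointly continuous in all their arguments, and differentiable in the actions (for $p_j,r_j$), respectively in $\theta_j$ (for $\pi_{\theta_j}$), with jointly continuous derivatives. Then $\widehat Q_i$ is differentiable in $a_i$ at $a=\pi(s)$, and $$\nabla_{\theta_i}J(\theta)=\frac1{1-\gamma}\ \underset{s_{\mathcal I_{\widehat Q}^i}\sim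 d^\pi}{\mathbb E}\Big[\nabla_{\theta_i}\pi_{\theta_i}(s_{\mathcal I_O^i})\,\nabla_{a_i}\widehat Q_i(s_{\mathcal I_{\widehat Q}^i},a_{\mathcal I_{\widehat Q}^i})\Big|_{a_k=\pi_{\theta_k}(s_{\mathcal I_O^k}),\ k\in \mathcal I_{\widehat Q}^i}\Big],$$ where $\nabla_{\theta_i}\pi_{\theta_i}$ is the transposed Jacobian and $s_{\mathcal I_{\widehat Q}^i}\sim d^\pi$ refers to the marginal of $d^\pi$. (b) Stochastic policies. Let $\mathcal S_j,\mathcal A_j$ be measurable spaces, let $\pi_{\theta_j}(a_j\mid o_j)\ge0$ be a probability density with respect to a $\sigma$-finite measure on $\mathcal A_j$ (for instance a counting or Lebesgue measure), and let the rewards be uniformly bounded. Suppose that for all $\vartheta$ in a neighbourhood of $\theta_i$ the density $\pi_\vartheta(a_i\mid o_i)$ is differentiable in $\vartheta$, with $\|\nabla_\vartheta\pi_\vartheta(a_i\mid o_i)\|\le g_{o_i}(a_i)$ for functions $g_{o_i}$ whose integrals over $\mathcal A_i$ are bounded uniformly in $o_i$. Then $$\nabla_{\theta_i}J(\theta)=\frac1{1-\gamma}\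 \underset{s_{\mathcal I_{\widehat Q}^i}\sim d^\pi,\ a_{\mathcal I_{\widehat Q}^i}\sim\hat\pi^i}{\mathbb E}\Big[\widehat Q_i(s_{\mathcal I_{\widehat Q}^i},a_{\mathcal I_{\widehat Q}^i})\,\nabla_{\theta_i}\ln\pi_{\theta_i}(a_i\mid s_{\mathcal I_O^i})\Big],\qquad \hat\pi^i=\prod_{j\in\mathcal I_{\widehat Q}^i}\pi_{\theta_j}(a_j\mid s_{\mathcal I_O^j}).$$ -/

import Mathlib

open MeasureTheory ProbabilityTheory

noncomputable section

namespace MARL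

/-- The product of finitely many Markov kernels with a common source: at `x` it is the product of
the probability measures `κ i x`. -/
def prodKernel {ι : Type*} [Fintype ι] {X : Type*} [MeasurableSpace X] {Y : ι → Type*}
    [∀ i, MeasurableSpace (Y i)] (κ : ∀ i, Kernel X (Y i)) [∀ i, IsMarkovKernel (κ i)] :
    Kernel X (∀ i, Y i) where
  toFun x := Measure.pi (fun i => κ i x)
  measurable' := by
    refine Measurable.measure_of_isPiSystem_of_isProbabilityMeasure
      generateFrom_pi.symm isPiSystem_pi ?_
    rintro _ ⟨t, ht, rfl⟩
    simp only [Measure.pi_pi]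
    exact Finset.measurable_prod _
      (fun i _ => Kernel.measurable_coe (κ i) (ht i (Set.mem_univ i)))

instance {ι : Type*} [Fintype ι] {X : Type*} [MeasurableSpace X] {Y : ι → Type*}
    [∀ i, MeasurableSpace (Y i)] (κ : ∀ i, Kernel X (Y i)) [∀ i, IsMarkovKernel (κ i)] :
    IsMarkovKernel (prodKernel κ) :=
  ⟨fun x => (inferInstance : IsProbabilityMeasure (Measure.pi (fun i => κ i x)))⟩

open Classical in
/-- The index set `{j | (j, i) ∈ E} ∪ {i}` of agent `i` in the directed graph with edges `E`. -/
def nbrs {V : Type*} [Fintype V] (E : V → V → Prop) (i : V) : Finset V :=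
  Finset.univ.filter (fun j => E j i ∨ j = i)

/-- A partially observable stochastic cooperative game: the state, observation and reward graphs
on the set `V` of agents, the local transition laws and rewards (functions of the states and the
actions of the in-neighbours, the agent included), and the discount factor. Agent `i` observes
the states of the agents in `nbrs EO i`. -/
structure Game (V : Type*) [Fintype V] (S A : V → Type*)
    [∀ j, MeasurableSpace (S j)] [∀ j, MeasurableSpace (A j)] where
  /-- edges `(j, i)` of the state graph -/
  ES : V → V → Prop
  /-- edges `(j, i)` of the observation graph -/
  EO : V → V → Prop
  /-- edges `(j, i)` of the reward graph -/
  ER : V → V → Prop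
  /-- local transition probabilities -/
  P : ∀ i, Kernel ((∀ k : nbrs ES i, S k) × (∀ k : nbrs ES i, A k)) (S i)
  markov : ∀ i, IsMarkovKernel (P i)
  /-- local rewards -/
  r : ∀ i, (∀ k : nbrs ER i, S k) × (∀ k : nbrs ER i, A k) → ℝ
  measurable_r : ∀ i, Measurable (r i)
  /-- discount factor -/
  γ : ℝ
  γ_nonneg : 0 ≤ γ
  γ_lt_one : γ < 1

namespace Game

variable {V : Type*} [Fintype V] {S A : V → Type*}
  [∀ j, MeasurableSpace (S j)] [∀ j, MeasurableSpace (A j)] (G : Game V S A)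

instance (i : V) : IsMarkovKernel (G.P i) := G.markov i

/-- The observation index set of an agent. -/
abbrev Iobs (i : V) : Finset V := nbrs G.EO i

/-- The observations of agent `i`. -/
abbrev Obs (i : V) : Type _ := ∀ k : G.Iobs i, S k

/-! ### Value dependency and gradient dependency -/

open Classical in
/-- `U i n` is the set of agents whose state or action, `n` steps before the final time, is an
ancestor of the reward of agent `i` at one of the remaining times. -/
def U (i : V) : ℕ → Finset V
  | 0 => (nbrs G.ER i).biUnion (fun j => G.Iobs j)
  | n + 1 => (nbrs G.ER i).biUnion (fun j => G.Iobs j) ∪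
      (U i n).biUnion (fun j => (nbrs G.ES j).biUnion (fun k => G.Iobs k))

open Classical in
/-- The value dependency set of agent `i` (infinite horizon): the union of the sets `U i n`. -/
def Iq (i : V) : Finset V := Finset.univ.filter (fun j => ∃ n, j ∈ G.U i n)

open Classical in
/-- The gradient dependency set of agent `i`: the agents `j` with `i` in the value dependency set
of `j` (in-neighbours in the transposed value dependency graph), and `i` itself. -/
def Igd (i : V) : Finset V := Finset.univ.filter (fun j => i ∈ G.Iq j ∨ j = i)

open Classical in
/-- The union of the value dependency sets over the gradient dependency set of agent `i`. -/
def Iqhat (i : V) : Finset V := (G.Igd i).biUnion (fun j => G.Iq j)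

theorem Iq_subset_Iqhat {i j : V} (h : j ∈ G.Igd i) : G.Iq j ⊆ G.Iqhat i := by
  classical
  exact Finset.subset_biUnion_of_mem (fun j => G.Iq j) h

theorem self_mem_nbrs (E : V → V → Prop) (i : V) : i ∈ nbrs E i := by
  simp [nbrs]

theorem self_mem_Iqhat (i : V) : i ∈ G.Iqhat i := by
  classical
  refine G.Iq_subset_Iqhat (j := i) (by simp [Igd]) ?_
  simp only [Iq, Finset.mem_filter, Finset.mem_univ, true_and]
  exact ⟨0, Finset.mem_biUnion.2 ⟨i, self_mem_nbrs _ i, self_mem_nbrs _ i⟩⟩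

theorem Iobs_subset_Iqhat {i : V} (j : G.Iqhat i) : G.Iobs j ⊆ G.Iqhat i := by
  classical
  obtain ⟨j, hj⟩ := j
  obtain ⟨k, hk, hjk⟩ := Finset.mem_biUnion.1 hj
  refine subset_trans ?_ (G.Iq_subset_Iqhat hk)
  intro l hl
  simp only [Iq, Finset.mem_filter, Finset.mem_univ, true_and] at hjk ⊢
  obtain ⟨n, hn⟩ := hjk
  exact ⟨n + 1, Finset.mem_union_right _
    (Finset.mem_biUnion.2 ⟨j, hn, Finset.mem_biUnion.2 ⟨j, self_mem_nbrs _ j, hl⟩⟩)⟩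

/-! ### Trajectories and value functions of local policies `κ j` -/

/-- The law of the next global state: the agents move independently given the current global
state and action. -/
def transition : Kernel ((∀ j, S j) × (∀ j, A j)) (∀ j, S j) :=
  prodKernel (fun i => (G.P i).comap
    (fun x => ((nbrs G.ES i).restrict x.1, (nbrs G.ES i).restrict x.2)) (by fun_prop))

instance : IsMarkovKernel G.transition := by
  unfold transition; infer_instance

variable (κ : ∀ j, Kernel (G.Obs j) (A j)) [∀ j, IsMarkovKernel (κ j)]

/-- The global policy: the agents draw their actions independently given their observations. -/
def globalPolicy : Kernel (∀ j, S j) (∀ j, A j) :=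
  prodKernel (fun j => (κ j).comap (fun s => (G.Iobs j).restrict s) (by fun_prop))

instance : IsMarkovKernel (G.globalPolicy κ) := by
  unfold globalPolicy; infer_instance

/-- One step of the chain of global states and actions. -/
def step : Kernel ((∀ j, S j) × (∀ j, A j)) ((∀ j, S j) × (∀ j, A j)) :=
  G.transition ⊗ₖ Kernel.prodMkLeft _ (G.globalPolicy κ)

instance : IsMarkovKernel (G.step κ) := by
  unfold step; infer_instance

/-- The law of the trajectory `(s(t), a(t))`, `t = 0, 1, …`, when `(s(0), a(0))` has law `μ`. -/
def trajLaw (μ : Measure ((∀ j, S j) × (∀ j, A j))) [IsProbabilityMeasure μ] :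
    Measure (ℕ → (∀ j, S j) × (∀ j, A j)) :=
  Kernel.trajMeasure (X := fun _ => (∀ j, S j) × (∀ j, A j)) μ
    (fun n => (G.step κ).comap
      (fun h : (∀ _ : Finset.Iic n, (∀ j, S j) × (∀ j, A j)) =>
        h ⟨n, Finset.mem_Iic.2 le_rfl⟩) (by fun_prop))

/-- The reward of agent `j` as a function of the global state and action. -/
def reward (j : V) (x : (∀ j, S j) × (∀ j, A j)) : ℝ :=
  G.r j ((nbrs G.ER j).restrict x.1, (nbrs G.ER j).restrict x.2)

/-- The local state-action value function of agent `j`. -/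
def Q (j : V) (s : ∀ j, S j) (a : ∀ j, A j) : ℝ :=
  ∫ ω, ∑' t : ℕ, G.γ ^ t * G.reward j (ω t) ∂(G.trajLaw κ (Measure.dirac (s, a)))

/-- The global state value function: the expectation of the discounted global reward. -/
def value (s : ∀ j, S j) : ℝ :=
  ∫ ω, ∑' t : ℕ, G.γ ^ t * ∑ j, G.reward j (ω t)
    ∂(G.trajLaw κ (Measure.dirac s ⊗ₘ G.globalPolicy κ))

/-- The expected global return for the initial state distribution `D`. -/
def expectedReturn (D : Measure (∀ j, S j)) : ℝ := ∫ s, G.value κ s ∂D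

/-- The discounted state visitation distribution `(1 - γ) ∑ₜ γᵗ Law(s(t))`, where `s(0)` has
law `D`. -/
def visitation (D : Measure (∀ j, S j)) [IsProbabilityMeasure D] : Measure (∀ j, S j) :=
  ENNReal.ofReal (1 - G.γ) • Measure.sum (fun t : ℕ =>
    ENNReal.ofReal (G.γ ^ t) •
      (G.trajLaw κ (D ⊗ₘ G.globalPolicy κ)).map (fun ω => (ω t).1))

/-- The marginal of the visitation distribution on the states of the agents in `Iqhat i`. -/
def visitationLoc (D : Measure (∀ j, S j)) [IsProbabilityMeasure D] (i : V) :
    Measure (∀ k : G.Iqhat i, S k) :=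
  (G.visitation κ D).map (G.Iqhat i).restrict

/-- The product of the local policies of the agents in `Iqhat i`, as a function of the states of
these agents. -/
def policyLoc (i : V) : Kernel (∀ k : G.Iqhat i, S k) (∀ k : G.Iqhat i, A k) :=
  prodKernel (fun j : G.Iqhat i =>
    (κ j).comap (fun s => Finset.restrict₂ (π := S) (G.Iobs_subset_Iqhat j) s) (by fun_prop))

/-- The observation of agent `j ∈ Iqhat i`, read off from the states of the agents in
`Iqhat i`. -/
def obsLoc {i : V} (j : G.Iqhat i) (s : ∀ k : G.Iqhat i, S k) : G.Obs j :=
  Finset.restrict₂ (π := S) (G.Iobs_subset_Iqhat j) s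

/-- Agent `i` as an element of `Iqhat i`. -/
def me (i : V) : G.Iqhat i := ⟨i, G.self_mem_Iqhat i⟩

/-- `q` gives the local critics as functions of the states and the actions of the agents in the
value dependency sets. -/
def IsLocalCritic (q : ∀ j, (∀ k : G.Iq j, S k) → (∀ k : G.Iq j, A k) → ℝ) : Prop :=
  ∀ j s a, G.Q κ j s a = q j ((G.Iq j).restrict s) ((G.Iq j).restrict a)

/-- The truncated critic of agent `i`: the sum over the gradient dependency set of the local
critics `q j`, a function of the states and the actions of the agents in `Iqhat i`. -/
def truncCritic (q : ∀ j, (∀ k : G.Iq j, S k) → (∀ k : G.Iq j, A k) → ℝ) (i : V)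
    (s : ∀ k : G.Iqhat i, S k) (a : ∀ k : G.Iqhat i, A k) : ℝ :=
  ∑ j : G.Igd i, q j (Finset.restrict₂ (π := S) (G.Iq_subset_Iqhat j.2) s)
    (Finset.restrict₂ (π := A) (G.Iq_subset_Iqhat j.2) a)

end Game

/-! ### Parameterized local policies -/

/-- A parameterized deterministic policy. -/
structure DetPolicy (Θ O A : Type*) [MeasurableSpace O] [MeasurableSpace A] where
  act : Θ → O → A
  measurable_act : ∀ ϑ, Measurable (act ϑ)

/-- The kernel that plays the action `act ϑ o` on observing `o`. -/
def DetPolicy.kernel {Θ O A : Type*} [MeasurableSpace O] [MeasurableSpace A]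
    (p : DetPolicy Θ O A) (ϑ : Θ) : Kernel O A :=
  Kernel.deterministic (p.act ϑ) (p.measurable_act ϑ)

instance {Θ O A : Type*} [MeasurableSpace O] [MeasurableSpace A]
    (p : DetPolicy Θ O A) (ϑ : Θ) : IsMarkovKernel (p.kernel ϑ) := by
  unfold DetPolicy.kernel; infer_instance

/-- A parameterized stochastic policy: a probability density `dens ϑ o a` in the action `a`, with
respect to the reference measure `ν` (a counting measure for discrete actions, Lebesgue measure
for continuous ones). -/
structure StochPolicy (Θ O A : Type*) [MeasurableSpace O] [MeasurableSpace A]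
    (ν : Measure A) where
  dens : Θ → O → A → ℝ
  dens_nonneg : ∀ ϑ o a, 0 ≤ dens ϑ o a
  measurable_dens : ∀ ϑ, Measurable (Function.uncurry (dens ϑ))
  lintegral_dens : ∀ ϑ o, ∫⁻ a, ENNReal.ofReal (dens ϑ o a) ∂ν = 1

/-- The kernel that draws the action with density `dens ϑ o` on observing `o`. -/
def StochPolicy.kernel {Θ O A : Type*} [MeasurableSpace O] [MeasurableSpace A]
    {ν : Measure A} [SigmaFinite ν] (p : StochPolicy Θ O A ν) (ϑ : Θ) : Kernel O A :=
  Kernel.withDensity (Kernel.const O ν) (fun o a => ENNReal.ofReal (p.dens ϑ o a))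

instance {Θ O A : Type*} [MeasurableSpace O] [MeasurableSpace A]
    {ν : Measure A} [SigmaFinite ν] (p : StochPolicy Θ O A ν) (ϑ : Θ) :
    IsMarkovKernel (p.kernel ϑ) := by
  refine ⟨fun o => ⟨?_⟩⟩
  have hm : Measurable (Function.uncurry (fun o a => ENNReal.ofReal (p.dens ϑ o a))) :=
    (p.measurable_dens ϑ).ennreal_ofReal
  rw [StochPolicy.kernel, Kernel.withDensity_apply' _ hm]
  simpa using p.lintegral_dens ϑ o

/-- Regularity in the parameter near `ϑ₀` that allows differentiation under the integral over the
actions: the density is differentiable in the parameter, and near `ϑ₀` its gradient has an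
integrable majorant in the action whose integral is bounded uniformly in the observation. -/
def StochPolicy.RegularAt {d : ℕ} {O A : Type*} [MeasurableSpace O] [MeasurableSpace A]
    {ν : Measure A} (p : StochPolicy (EuclideanSpace ℝ (Fin d)) O A ν)
    (ϑ₀ : EuclideanSpace ℝ (Fin d)) : Prop :=
  ∃ ε > 0, ∃ C : ℝ, ∀ o, ∃ g : A → ℝ, Integrable g ν ∧ ∫ a, g a ∂ν ≤ C ∧
    ∀ ϑ ∈ Metric.ball ϑ₀ ε, ∀ a, DifferentiableAt ℝ (fun ϑ' => p.dens ϑ' o a) ϑ ∧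
      ‖gradient (fun ϑ' => p.dens ϑ' o a) ϑ‖ ≤ g a

/-- `f` is continuous, and continuously differentiable in its second variable, jointly in both
variables. -/
def ContC1 {X E F : Type*} [TopologicalSpace X] [NormedAddCommGroup E] [NormedSpace ℝ E]
    [NormedAddCommGroup F] [NormedSpace ℝ F] (f : X → E → F) : Prop :=
  Continuous (Function.uncurry f) ∧ (∀ x, Differentiable ℝ (f x)) ∧
    Continuous (fun y : X × E => fderiv ℝ (f y.1) y.2)

namespace Game

variable {V : Type*} [Fintype V] [DecidableEq V] {S : V → Type*}
  [∀ j, MeasurableSpace (S j)] {d : V → ℕ}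

section Det

variable {m : V → ℕ} (G : Game V S (fun j => EuclideanSpace ℝ (Fin (m j))))
  (π : ∀ j, DetPolicy (EuclideanSpace ℝ (Fin (d j))) (G.Obs j) (EuclideanSpace ℝ (Fin (m j))))
  (θ : ∀ j, EuclideanSpace ℝ (Fin (d j)))
  (q : ∀ j, (∀ k : G.Iq j, S k) → (∀ k : G.Iq j, EuclideanSpace ℝ (Fin (m k))) → ℝ) (i : V)

/-- The truncated critic of agent `i` as a function of the action `b` of agent `i`, while the
other agents in `Iqhat i` play the actions given by their policies. -/
def criticOfAction (s : ∀ k : G.Iqhat i, S k) (b : EuclideanSpace ℝ (Fin (m i))) : ℝ :=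
  G.truncCritic q i s (Function.update
    (fun k : G.Iqhat i => (π k).act (θ k) (G.obsLoc k s)) (G.me i) b)

/-- The action of agent `i`, as a function of the states of the agents in `Iqhat i`. -/
def actionLoc (s : ∀ k : G.Iqhat i, S k) : EuclideanSpace ℝ (Fin (m i)) :=
  (π i).act (θ i) (G.obsLoc (G.me i) s)

/-- The vector `∇_{θ_i} π_{θ_i} ∇_{a_i} Q̂_i` at `a_i = π_{θ_i}`, where `∇_{θ_i} π_{θ_i}` is the
transposed Jacobian. -/
def detIntegrand (s : ∀ k : G.Iqhat i, S k) : EuclideanSpace ℝ (Fin (d i)) :=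
  ContinuousLinearMap.adjoint (fderiv ℝ (fun ϑ => (π i).act ϑ (G.obsLoc (G.me i) s)) (θ i))
    (gradient (G.criticOfAction π θ q i s) (G.actionLoc π θ i s))

end Det

section Stoch

variable {A : V → Type*} [∀ j, MeasurableSpace (A j)] (G : Game V S A) {ν : ∀ j, Measure (A j)}
  (π : ∀ j, StochPolicy (EuclideanSpace ℝ (Fin (d j))) (G.Obs j) (A j) (ν j))
  (θ : ∀ j, EuclideanSpace ℝ (Fin (d j)))
  (q : ∀ j, (∀ k : G.Iq j, S k) → (∀ k : G.Iq j, A k) → ℝ) (i : V)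

/-- The vector `Q̂_i ∇_{θ_i} ln π_{θ_i}(a_i | o_i)`. -/
def stochIntegrand (x : (∀ k : G.Iqhat i, S k) × (∀ k : G.Iqhat i, A k)) :
    EuclideanSpace ℝ (Fin (d i)) :=
  G.truncCritic q i x.1 x.2 •
    gradient (fun ϑ => Real.log ((π i).dens ϑ (G.obsLoc (G.me i) x.1) (x.2 (G.me i)))) (θ i)

end Stoch

end Game

end MARL

end

noncomputable section

set_option linter.unusedSectionVars false

namespace MARL

/-! ### Marginals and discounted sums of a Markov chain -/

section Chain

variable {X : Type*} [MeasurableSpace X]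

/-! Move only the parameter of agent `i`, from its value in `θ` to `ϑ`, and let `w = V_ϑ - V_θ`.
Subtracting the two Bellman equations gives `w = a₁ + γ a₂ + γ P w`, where `P` is the state
transition operator of the unperturbed policy, `a₁(s) = ∫ Q_θ(s, ·) d(π_ϑ - π_θ)` is the gain from
deviating for one step, and `a₂` is the integral of the one-step expectation of `w` against the same
difference of policies. Iterating this Poisson equation along the unperturbed chain yields `∫ w dD =
(1 - γ)⁻¹ ∫ (a₁ + γ a₂) dd^π` (`integral_of_poisson`). If averaged rewards and transitions are
Lipschitz in `ϑ`, uniformly in the state, the source term is `O(‖ϑ - θ‖)`; hence so is `w`, hence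
`a₂` is quadratically small and does not contribute to the derivative. What remains is the
`d^π`-average of the gradient of `ϑ ↦ ∫ Q_θ(s, ·) dπ_ϑ` with the critic frozen
(`hasFDerivAt_return`). Neither the visitation distribution nor the value function is ever
differentiated in the state.

Locality comes from the set `Iq j`: it contains the reward neighbours of `j` and is closed under the
influences of one step, so the law of the next states and actions inside `Iq j` depends on the
current ones inside `Iq j` only, and `Q_j` is a function of these (`Q_eq_of_agreeOn`). An agent `j`
outside `Igd i` has `i ∉ Iq j`, so its critic ignores the action of `i`; in `∑ Q_j` only the
truncated critic varies with that action (`sum_Q_update`). The integrand then lives on `Iqhat i`,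
and the average may be taken over marginals.

The two cases supply the Lipschitz bounds and the gradient of the frozen critic. For stochastic
policies the other agents are integrated out and the density of agent `i` is differentiated under
the integral, with its gradient written as density times score (`RegularAt.exists_integral_bound`).
For deterministic policies the joint action law is a Dirac measure; one Bellman step shows that
`Q_j` is continuously differentiable in the actions (`contC1_Q`), the gradient is the chain rule,
and compactness gives the uniform bounds. -/

/-- The `n`-step transition kernel of a Markov chain. -/
def kernelIter (K : Kernel X X) : ℕ → Kernel X X
  | 0 => Kernel.id
  | n + 1 => K ∘ₖ kernelIter K n

variable (K : Kernel X X) [IsMarkovKernel K]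

instance (n : ℕ) : IsMarkovKernel (kernelIter K n) := by
  induction n with
  | zero => unfold kernelIter; infer_instance
  | succ n ih => unfold kernelIter; infer_instance

/-- The defining recursion appends a step at the end of the chain. The Bellman equation and the
induction over dependency sets condition on the first step instead. -/
theorem kernelIter_succ' (n : ℕ) : kernelIter K (n + 1) = kernelIter K n ∘ₖ K := by
  induction n with
  | zero => simp [kernelIter]
  | succ n ih =>
    rw [kernelIter, ih, ← Kernel.comp_assoc, ← ih, kernelIter]

theorem kernelIter_succ_apply (n : ℕ) (x : X) :
    kernelIter K (n + 1) x = kernelIter K n ∘ₘ K x := by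
  rw [kernelIter_succ', Kernel.comp_apply]

/-- The law of the trajectory of a time-homogeneous Markov chain. -/
abbrev chainLaw (μ : Measure X) [IsProbabilityMeasure μ] : Measure (ℕ → X) :=
  Kernel.trajMeasure (X := fun _ => X) μ
    (fun n => K.comap (fun h : (∀ _ : Finset.Iic n, X) => h ⟨n, Finset.mem_Iic.2 le_rfl⟩)
      (by fun_prop))

theorem map_eval_zero_chainLaw (μ : Measure X) [IsProbabilityMeasure μ] :
    (chainLaw K μ).map (fun ω => ω 0) = μ := by
  have h : (fun ω : ℕ → X => ω 0) =
      (fun h : (∀ _ : Finset.Iic 0, X) => h ⟨0, Finset.mem_Iic.2 le_rfl⟩) ∘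
        (Preorder.frestrictLe (π := fun _ => X) 0) := rfl
  rw [h, ← Measure.map_map (by fun_prop) (by fun_prop), chainLaw, Kernel.trajMeasure,
    Measure.map_comp _ _ (by fun_prop), Kernel.traj_map_frestrictLe, Kernel.partialTraj_self,
    Measure.id_comp, Measure.map_map (by fun_prop) (by fun_prop)]
  convert Measure.map_id
  funext x
  rfl

/-- The history up to time `n` and the next state have a joint law that disintegrates through the
transition kernel. This kernel reads only the last entry of the history, so the second marginal
depends only on the law at time `n`. -/
theorem map_eval_succ_chainLaw (μ : Measure X) [IsProbabilityMeasure μ] (n : ℕ) :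
    (chainLaw K μ).map (fun ω => ω (n + 1)) = K ∘ₘ (chainLaw K μ).map (fun ω => ω n) := by
  have h := Kernel.map_frestrictLe_trajMeasure_compProd_eq_map_trajMeasure (X := fun _ => X)
    (μ₀ := μ) (κ := fun n => K.comap
      (fun h : (∀ _ : Finset.Iic n, X) => h ⟨n, Finset.mem_Iic.2 le_rfl⟩) (by fun_prop)) (a := n)
  have h2 := congrArg (fun m => m.map Prod.snd) h
  rw [Measure.map_map (by fun_prop) (by fun_prop), ← Measure.snd, Measure.snd_compProd] at h2
  rw [show (fun ω : ℕ → X => ω n) =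
      (fun h : (∀ _ : Finset.Iic n, X) => h ⟨n, Finset.mem_Iic.2 le_rfl⟩) ∘
        (Preorder.frestrictLe (π := fun _ => X) n) from rfl,
    ← Measure.map_map (by fun_prop) (by fun_prop)]
  refine h2.symm.trans ?_
  rw [← Measure.deterministic_comp_eq_map
    (f := fun h : (∀ _ : Finset.Iic n, X) => h ⟨n, Finset.mem_Iic.2 le_rfl⟩) (by fun_prop),
    Measure.comp_assoc, Kernel.comp_deterministic_eq_comap]

/-- Returns and visitation measures involve one time at a time, so these marginals are all that is
needed of the trajectory law. -/
theorem map_eval_chainLaw (μ : Measure X) [IsProbabilityMeasure μ] (n : ℕ) :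
    (chainLaw K μ).map (fun ω => ω n) = kernelIter K n ∘ₘ μ := by
  induction n with
  | zero => rw [map_eval_zero_chainLaw, kernelIter, Measure.id_comp]
  | succ n ih => rw [map_eval_succ_chainLaw, ih, kernelIter, Measure.comp_assoc]

/-- The expected discounted sum of `f` along the chain started at `x`. -/
def discSum (γ : ℝ) (f : X → ℝ) (x : X) : ℝ := ∑' t : ℕ, γ ^ t * ∫ y, f y ∂(kernelIter K t x)

theorem integral_measure_comp {Y : Type*} [MeasurableSpace Y] {κ : Kernel X Y} {μ : Measure X}
    {f : Y → ℝ} (h : Integrable f (κ ∘ₘ μ)) :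
    ∫ y, f y ∂(κ ∘ₘ μ) = ∫ x, ∫ y, f y ∂(κ x) ∂μ := by
  rw [Measure.comp_eq_comp_const_apply] at h ⊢
  rw [Kernel.integral_comp h, Kernel.const_apply]

theorem integrable_of_ae_abs_le {μ : Measure X} [IsFiniteMeasure μ] {f : X → ℝ} {B : ℝ}
    (hf : Measurable f) (hB : ∀ᵐ x ∂μ, |f x| ≤ B) : Integrable f μ :=
  Integrable.of_bound hf.aestronglyMeasurable B hB

theorem abs_integral_le_of_ae {μ : Measure X} [IsProbabilityMeasure μ] {f : X → ℝ} {B : ℝ}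
    (hB : ∀ᵐ x ∂μ, |f x| ≤ B) : |∫ x, f x ∂μ| ≤ B := by
  simpa using norm_integral_le_of_norm_le_const (f := f) hB

variable {K} {γ : ℝ} {f : X → ℝ} {B : ℝ}

/-- A bound along the chain, rather than everywhere, is what deterministic policies allow: a
continuous reward need not be bounded on all of the action space, but it is bounded on the actions
actually played. Time `0` is covered by `hμ`, every later time by the last step taken. -/
theorem ae_kernelIter_comp (hf : Measurable f) (hB : ∀ x, ∀ᵐ y ∂K x, |f y| ≤ B)
    {μ : Measure X} (hμ : ∀ᵐ y ∂μ, |f y| ≤ B) (n : ℕ) :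
    ∀ᵐ y ∂(kernelIter K n ∘ₘ μ), |f y| ≤ B := by
  have hm : MeasurableSet {y | |f y| ≤ B} := measurableSet_le (by fun_prop) (by fun_prop)
  cases n with
  | zero => rwa [kernelIter, Measure.id_comp]
  | succ n =>
    rw [kernelIter, ← Measure.comp_assoc]
    exact Measure.ae_comp_of_ae_ae hm (Filter.Eventually.of_forall hB)

theorem ae_kernelIter (hf : Measurable f) (hB : ∀ x, ∀ᵐ y ∂K x, |f y| ≤ B)
    {x : X} (hx : |f x| ≤ B) (n : ℕ) : ∀ᵐ y ∂(kernelIter K n x), |f y| ≤ B := by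
  have hm : MeasurableSet {y | |f y| ≤ B} := measurableSet_le (by fun_prop) (by fun_prop)
  have h := ae_kernelIter_comp (μ := Measure.dirac x) hf hB
    ((ae_dirac_iff hm).2 hx) n
  rwa [Measure.dirac_bind (Kernel.measurable _)] at h

theorem summable_discSum (hf : Measurable f) (h0 : 0 ≤ γ) (h1 : γ < 1)
    (hB : ∀ x, ∀ᵐ y ∂K x, |f y| ≤ B) (x : X) :
    Summable (fun t : ℕ => γ ^ t * ∫ y, f y ∂(kernelIter K t x)) := by
  -- The starting point is arbitrary, so `B` bounds `f` only from time `1` on; the maximum takes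
  -- care of time `0`.
  refine Summable.of_norm_bounded (g := fun t => γ ^ t * max B |f x|)
    ((summable_geometric_of_lt_one h0 h1).mul_right _) fun t => ?_
  rw [norm_mul, norm_pow, Real.norm_of_nonneg h0]
  refine mul_le_mul_of_nonneg_left (abs_integral_le_of_ae ?_) (by positivity)
  exact ae_kernelIter hf (fun x => (hB x).mono fun y hy => hy.trans (le_max_left _ _))
    (le_max_right _ _) t

theorem abs_discSum_le (hf : Measurable f) (h0 : 0 ≤ γ) (h1 : γ < 1)
    (hB : ∀ x, ∀ᵐ y ∂K x, |f y| ≤ B) {x : X} (hx : |f x| ≤ B) :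
    |discSum K γ f x| ≤ (1 - γ)⁻¹ * B := by
  refine tsum_of_norm_bounded (E := ℝ) ((hasSum_geometric_of_lt_one h0 h1).mul_right B) fun t => ?_
  rw [norm_mul, norm_pow, Real.norm_of_nonneg h0]
  exact mul_le_mul_of_nonneg_left (abs_integral_le_of_ae (ae_kernelIter hf hB hx t))
    (by positivity)

theorem measurable_discSum (hf : Measurable f) (h0 : 0 ≤ γ) (h1 : γ < 1)
    (hB : ∀ x, ∀ᵐ y ∂K x, |f y| ≤ B) : Measurable (discSum K γ f) := by
  refine measurable_of_tendsto_metrizable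
    (f := fun n x => ∑ t ∈ Finset.range n, γ ^ t * ∫ y, f y ∂(kernelIter K t x)) (fun n => ?_)
    (tendsto_pi_nhds.2 fun x => (summable_discSum hf h0 h1 hB x).hasSum.tendsto_sum_nat)
  refine Finset.measurable_sum _ fun t _ => Measurable.const_mul ?_ _
  exact (hf.stronglyMeasurable.integral_kernel (κ := kernelIter K t)).measurable

theorem integral_discSum (hf : Measurable f) (h0 : 0 ≤ γ) (h1 : γ < 1)
    (hB : ∀ x, ∀ᵐ y ∂K x, |f y| ≤ B) (μ : Measure X) [IsProbabilityMeasure μ]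
    (hμ : ∀ᵐ y ∂μ, |f y| ≤ B) :
    ∫ x, discSum K γ f x ∂μ = ∑' t : ℕ, γ ^ t * ∫ y, f y ∂(kernelIter K t ∘ₘ μ) := by
  have hi : ∀ t, Integrable f (kernelIter K t ∘ₘ μ) := fun t =>
    integrable_of_ae_abs_le hf (ae_kernelIter_comp hf hB hμ t)
  have hs : ∀ t, StronglyMeasurable (fun x => γ ^ t * ∫ y, f y ∂(kernelIter K t x)) := fun t =>
    (hf.stronglyMeasurable.integral_kernel (κ := kernelIter K t)).const_mul _
  have hb : ∀ t, ∀ᵐ x ∂μ, ‖γ ^ t * ∫ y, f y ∂(kernelIter K t x)‖ ≤ γ ^ t * B := fun t => by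
    filter_upwards [hμ] with x hx
    rw [norm_mul, norm_pow, Real.norm_of_nonneg h0]
    exact mul_le_mul_of_nonneg_left (abs_integral_le_of_ae (ae_kernelIter hf hB hx t))
      (by positivity)
  have hI : ∀ t, Integrable (fun x => γ ^ t * ∫ y, f y ∂(kernelIter K t x)) μ := fun t =>
    Integrable.of_bound (hs t).aestronglyMeasurable _ (hb t)
  have := hasSum_integral_of_summable_integral_norm hI
    (Summable.of_norm_bounded (g := fun t => γ ^ t * B)
      ((summable_geometric_of_lt_one h0 h1).mul_right _) fun t => by
        have := norm_integral_le_of_norm_le_const (μ := μ)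
          (f := fun x => ‖γ ^ t * ∫ y, f y ∂(kernelIter K t x)‖) (C := γ ^ t * B)
          (by simpa only [norm_norm] using hb t)
        simpa using this)
  unfold discSum
  rw [← this.tsum_eq]
  refine tsum_congr fun t => ?_
  rw [integral_const_mul, integral_measure_comp (hi t)]

theorem integral_chainLaw (hf : Measurable f) (h0 : 0 ≤ γ) (h1 : γ < 1)
    (hB : ∀ x, ∀ᵐ y ∂K x, |f y| ≤ B) (μ : Measure X) [IsProbabilityMeasure μ]
    (hμ : ∀ᵐ y ∂μ, |f y| ≤ B) :
    ∫ ω, ∑' t : ℕ, γ ^ t * f (ω t) ∂(chainLaw K μ) = ∫ x, discSum K γ f x ∂μ := by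
  rw [integral_discSum hf h0 h1 hB μ hμ]
  have hm : MeasurableSet {y | |f y| ≤ B} := measurableSet_le (by fun_prop) (by fun_prop)
  have he : ∀ t : ℕ, Measurable (fun ω : ℕ → X => ω t) := fun t => by fun_prop
  have hb : ∀ t : ℕ, ∀ᵐ ω ∂(chainLaw K μ), ‖γ ^ t * f (ω t)‖ ≤ γ ^ t * B := fun t => by
    have := ae_kernelIter_comp hf hB hμ t
    rw [← map_eval_chainLaw] at this
    filter_upwards [ae_of_ae_map (he t).aemeasurable this] with ω hω
    rw [norm_mul, norm_pow, Real.norm_of_nonneg h0]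
    exact mul_le_mul_of_nonneg_left hω (by positivity)
  have hI : ∀ t : ℕ, Integrable (fun ω => γ ^ t * f (ω t)) (chainLaw K μ) := fun t =>
    Integrable.of_bound ((hf.comp (he t)).const_mul _).aestronglyMeasurable _ (hb t)
  have := hasSum_integral_of_summable_integral_norm hI
    (Summable.of_norm_bounded (g := fun t => γ ^ t * B)
      ((summable_geometric_of_lt_one h0 h1).mul_right _) fun t => by
        have := norm_integral_le_of_norm_le_const (μ := chainLaw K μ)
          (f := fun ω => ‖γ ^ t * f (ω t)‖) (C := γ ^ t * B)
          (by simpa only [norm_norm] using hb t)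
        simpa using this)
  rw [← this.tsum_eq]
  refine tsum_congr fun t => ?_
  rw [integral_const_mul, ← map_eval_chainLaw,
    integral_map (he t).aemeasurable hf.aestronglyMeasurable]

theorem integral_chainLaw_dirac (hf : Measurable f) (h0 : 0 ≤ γ) (h1 : γ < 1)
    (hB : ∀ x, ∀ᵐ y ∂K x, |f y| ≤ B) (x : X) :
    ∫ ω, ∑' t : ℕ, γ ^ t * f (ω t) ∂(chainLaw K (Measure.dirac x)) = discSum K γ f x := by
  have hm : MeasurableSet {y | |f y| ≤ max B |f x|} :=
    measurableSet_le (by fun_prop) (by fun_prop)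
  rw [integral_chainLaw hf h0 h1
    (fun x => (hB x).mono fun y hy => hy.trans (le_max_left B |f _|)) _
    ((ae_dirac_iff hm).2 (le_max_right B |f x|)),
    integral_dirac' _ _ (measurable_discSum hf h0 h1 hB).stronglyMeasurable]

/-- Bellman equation: split off the term `t = 0`; the rest, with one factor `γ` taken out, is the
same series for the chain started from the law `K x`. -/
theorem discSum_eq (hf : Measurable f) (h0 : 0 ≤ γ) (h1 : γ < 1)
    (hB : ∀ x, ∀ᵐ y ∂K x, |f y| ≤ B) (x : X) :
    discSum K γ f x = f x + γ * ∫ y, discSum K γ f y ∂(K x) := by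
  rw [integral_discSum hf h0 h1 hB _ (hB x), discSum,
    (summable_discSum hf h0 h1 hB x).tsum_eq_zero_add, ← tsum_mul_left]
  congr 1
  · rw [kernelIter, Kernel.id_apply, integral_dirac' _ _ hf.stronglyMeasurable]
    simp
  · refine tsum_congr fun t => ?_
    rw [kernelIter_succ_apply, pow_succ]
    ring

theorem ae_abs_discSum_le (hf : Measurable f) (h0 : 0 ≤ γ) (h1 : γ < 1)
    (hB : ∀ x, ∀ᵐ y ∂K x, |f y| ≤ B) {μ : Measure X} (hμ : ∀ᵐ y ∂μ, |f y| ≤ B) :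
    ∀ᵐ y ∂μ, |discSum K γ f y| ≤ (1 - γ)⁻¹ * B :=
  hμ.mono fun _ hy => abs_discSum_le hf h0 h1 hB hy

end Chain

end MARL

namespace MARL

/-! ### Controlled Markov chains -/

section Control

variable {S A : Type*} [MeasurableSpace S] [MeasurableSpace A]

/-- One step of the chain of states and actions with transition law `T` and policy `π`. -/
abbrev ctrlStep (T : Kernel (S × A) S) (π : Kernel S A) : Kernel (S × A) (S × A) :=
  T ⊗ₖ Kernel.prodMkLeft _ π

/-- The value of the policy `π`: the expected discounted sum of the rewards `R`. -/
def ctrlValue (T : Kernel (S × A) S) (π : Kernel S A) (γ : ℝ) (R : S × A → ℝ) (s : S) : ℝ :=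
  ∫ a, discSum (ctrlStep T π) γ R (s, a) ∂(π s)

/-- The law of the state at time `t`, when the initial state has law `D`. -/
def stateLaw (T : Kernel (S × A) S) (π : Kernel S A) (D : Measure S) (t : ℕ) : Measure S :=
  (kernelIter (ctrlStep T π) t ∘ₘ (D ⊗ₘ π)).fst

/-- The discounted visitation measure `(1 - γ) ∑ₜ γᵗ μ t`. -/
def discVisit (γ : ℝ) (μ : ℕ → Measure S) : Measure S :=
  ENNReal.ofReal (1 - γ) • Measure.sum (fun t : ℕ => ENNReal.ofReal (γ ^ t) • μ t)

theorem isProbabilityMeasure_discVisit {γ : ℝ} (h0 : 0 ≤ γ) (h1 : γ < 1) (μ : ℕ → Measure S)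
    [∀ t, IsProbabilityMeasure (μ t)] : IsProbabilityMeasure (discVisit γ μ) := by
  constructor
  simp only [discVisit, Measure.smul_apply, Measure.sum_apply _ MeasurableSet.univ, measure_univ,
    smul_eq_mul, mul_one]
  rw [← ENNReal.ofReal_tsum_of_nonneg (fun n => by positivity)
    (summable_geometric_of_lt_one h0 h1), tsum_geometric_of_lt_one h0 h1,
    ← ENNReal.ofReal_mul (by linarith), mul_inv_cancel₀ (by linarith), ENNReal.ofReal_one]

theorem integral_discVisit {γ : ℝ} (h0 : 0 ≤ γ) (h1 : γ < 1) (μ : ℕ → Measure S)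
    [∀ t, IsProbabilityMeasure (μ t)] {f : S → ℝ} (hf : Measurable f) {B : ℝ}
    (hB : ∀ s, |f s| ≤ B) :
    ∫ s, f s ∂(discVisit γ μ) = (1 - γ) * ∑' t : ℕ, γ ^ t * ∫ s, f s ∂(μ t) := by
  have := isProbabilityMeasure_discVisit h0 h1 μ
  have hi : Integrable f (discVisit γ μ) :=
    Integrable.of_bound hf.aestronglyMeasurable B (.of_forall hB)
  have hc : ENNReal.ofReal (1 - γ) ≠ 0 := by simpa using h1
  rw [discVisit, integrable_smul_measure hc ENNReal.ofReal_ne_top] at hi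
  rw [discVisit, integral_smul_measure, ENNReal.toReal_ofReal (by linarith), smul_eq_mul,
    ← (hasSum_integral_measure hi).tsum_eq]
  congr 1
  refine tsum_congr fun t => ?_
  rw [integral_smul_measure, ENNReal.toReal_ofReal (by positivity), smul_eq_mul]

variable {T : Kernel (S × A) S} {π : Kernel S A} [IsMarkovKernel T] [IsMarkovKernel π]
  {γ : ℝ} {R : S × A → ℝ} {B : ℝ}

theorem ctrlStep_apply (x : S × A) : ctrlStep T π x = T x ⊗ₘ π := by
  rw [Kernel.compProd_apply_eq_compProd_sectR]
  rfl

theorem ctrlStep_comp (ν : Measure (S × A)) [SFinite ν] :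
    ctrlStep T π ∘ₘ ν = (T ∘ₘ ν) ⊗ₘ π := by
  ext s hs
  rw [Measure.bind_apply hs (Kernel.aemeasurable _), Measure.compProd_apply hs,
    Measure.lintegral_bind (Kernel.aemeasurable _)
      (Kernel.measurable_kernel_prodMk_left hs).aemeasurable]
  refine lintegral_congr fun x => ?_
  rw [ctrlStep_apply, Measure.compProd_apply hs]

instance (D : Measure S) [IsProbabilityMeasure D] (t : ℕ) :
    IsProbabilityMeasure (stateLaw T π D t) := by
  unfold stateLaw; infer_instance

/-- At every time the action is drawn from the policy given the state, so the chain of states and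
actions is determined by its state marginals. -/
theorem kernelIter_comp_eq (D : Measure S) [IsProbabilityMeasure D] (t : ℕ) :
    kernelIter (ctrlStep T π) t ∘ₘ (D ⊗ₘ π) = stateLaw T π D t ⊗ₘ π := by
  cases t with
  | zero => simp [stateLaw, kernelIter]
  | succ t =>
    rw [stateLaw, kernelIter, ← Measure.comp_assoc, ctrlStep_comp, Measure.fst_compProd]

theorem stateLaw_zero (D : Measure S) [IsProbabilityMeasure D] : stateLaw T π D 0 = D := by
  simp [stateLaw, kernelIter]

theorem stateLaw_succ (D : Measure S) [IsProbabilityMeasure D] (t : ℕ) :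
    stateLaw T π D (t + 1) = T ∘ₘ (stateLaw T π D t ⊗ₘ π) := by
  rw [← kernelIter_comp_eq, stateLaw, kernelIter, ← Measure.comp_assoc, ctrlStep_comp,
    Measure.fst_compProd]

theorem integral_stateLaw_succ (D : Measure S) [IsProbabilityMeasure D] (t : ℕ) {w : S → ℝ}
    (hw : Measurable w) {M : ℝ} (hM : ∀ s, |w s| ≤ M) :
    ∫ s, w s ∂(stateLaw T π D (t + 1)) =
      ∫ s, ∫ a, ∫ s', w s' ∂(T (s, a)) ∂(π s) ∂(stateLaw T π D t) := by
  rw [stateLaw_succ, integral_measure_comp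
    (Integrable.of_bound hw.aestronglyMeasurable M (.of_forall hM)), Measure.integral_compProd]
  refine Integrable.of_bound (C := M) ?_ (.of_forall fun x => ?_)
  · exact (hw.stronglyMeasurable.integral_kernel (κ := T)).aestronglyMeasurable
  · exact abs_integral_le_of_ae (.of_forall hM)

theorem measurable_integral_transition {w : S → ℝ} (hw : Measurable w) :
    Measurable (fun x => ∫ s', w s' ∂(T x)) :=
  (hw.stronglyMeasurable.integral_kernel (κ := T)).measurable

theorem measurable_integral_policy {f : S × A → ℝ} (hf : Measurable f) :
    Measurable (fun s => ∫ a, f (s, a) ∂(π s)) :=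
  (hf.stronglyMeasurable.integral_kernel_prod_right' (κ := π)).measurable

/-- If `w = f + γ M w` for the state transition operator `M`, the integral of `w` is the
discounted sum of the integrals of `f`. -/
theorem hasSum_of_poisson (h0 : 0 ≤ γ) (h1 : γ < 1) (D : Measure S) [IsProbabilityMeasure D]
    {w f : S → ℝ} (hw : Measurable w) {M : ℝ} (hM : ∀ s, |w s| ≤ M)
    (hf : Measurable f) {F : ℝ} (hF : ∀ s, |f s| ≤ F)
    (h : ∀ s, w s = f s + γ * ∫ a, ∫ s', w s' ∂(T (s, a)) ∂(π s)) :
    HasSum (fun t : ℕ => γ ^ t * ∫ s, f s ∂(stateLaw T π D t)) (∫ s, w s ∂D) := by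
  have hstep : ∀ t, ∫ s, w s ∂(stateLaw T π D t) =
      ∫ s, f s ∂(stateLaw T π D t) + γ * ∫ s, w s ∂(stateLaw T π D (t + 1)) := by
    intro t
    rw [integral_stateLaw_succ D t hw hM, ← integral_const_mul, ← integral_add]
    · exact integral_congr_ae (.of_forall h)
    · exact Integrable.of_bound hf.aestronglyMeasurable F (.of_forall hF)
    · refine Integrable.const_mul (Integrable.of_bound (C := M) ?_ (.of_forall fun s => ?_)) _
      · exact (measurable_integral_policy
          (measurable_integral_transition hw)).aestronglyMeasurable
      · exact abs_integral_le_of_ae (.of_forall fun a => abs_integral_le_of_ae (.of_forall hM))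
  -- By `hstep` the partial sums telescope, and the remainder is at most `γ ^ n * M`.
  have hpart : ∀ n, ∑ t ∈ Finset.range n, γ ^ t * ∫ s, f s ∂(stateLaw T π D t) =
      ∫ s, w s ∂D - γ ^ n * ∫ s, w s ∂(stateLaw T π D n) := by
    intro n
    induction n with
    | zero => simp [stateLaw_zero]
    | succ n ih =>
      rw [Finset.sum_range_succ, ih, hstep n, pow_succ]
      ring
  have hs : Summable (fun t : ℕ => γ ^ t * ∫ s, f s ∂(stateLaw T π D t)) := by
    refine Summable.of_norm_bounded (g := fun t => γ ^ t * F)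
      ((summable_geometric_of_lt_one h0 h1).mul_right _) fun t => ?_
    rw [norm_mul, norm_pow, Real.norm_of_nonneg h0]
    exact mul_le_mul_of_nonneg_left (abs_integral_le_of_ae (.of_forall hF)) (by positivity)
  rw [hs.hasSum_iff_tendsto_nat]
  simp_rw [hpart]
  have hz : Filter.Tendsto (fun n : ℕ => γ ^ n * ∫ s, w s ∂(stateLaw T π D n)) Filter.atTop
      (nhds 0) := by
    refine squeeze_zero_norm (a := fun n => γ ^ n * M) (fun n => ?_) ?_
    · rw [norm_mul, norm_pow, Real.norm_of_nonneg h0]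
      exact mul_le_mul_of_nonneg_left (abs_integral_le_of_ae (.of_forall hM)) (by positivity)
    · simpa using (tendsto_pow_atTop_nhds_zero_of_lt_one h0 h1).mul_const M
  simpa using hz.const_sub (∫ s, w s ∂D)

/-- Start the chain at `s` and bound the series termwise. The a priori bound `M` serves only for
convergence; the resulting bound scales with the source, which makes bootstrapping possible. -/
theorem abs_le_of_poisson (h0 : 0 ≤ γ) (h1 : γ < 1)
    {w f : S → ℝ} (hw : Measurable w) {M : ℝ} (hM : ∀ s, |w s| ≤ M)
    (hf : Measurable f) {F : ℝ} (hF : ∀ s, |f s| ≤ F)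
    (h : ∀ s, w s = f s + γ * ∫ a, ∫ s', w s' ∂(T (s, a)) ∂(π s)) (s : S) :
    |w s| ≤ (1 - γ)⁻¹ * F := by
  have h2 := hasSum_of_poisson h0 h1 (Measure.dirac s) hw hM hf hF h
  rw [integral_dirac' _ _ hw.stronglyMeasurable] at h2
  refine h2.norm_le_of_bounded (E := ℝ) ((hasSum_geometric_of_lt_one h0 h1).mul_right F) fun t => ?_
  rw [norm_mul, norm_pow, Real.norm_of_nonneg h0]
  exact mul_le_mul_of_nonneg_left (abs_integral_le_of_ae (.of_forall hF)) (by positivity)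

/-- The visitation measure is the normalized resolvent of the state chain applied to `D`, so it
inverts the Poisson equation in integrated form. -/
theorem integral_of_poisson (h0 : 0 ≤ γ) (h1 : γ < 1) (D : Measure S) [IsProbabilityMeasure D]
    {w f : S → ℝ} (hw : Measurable w) {M : ℝ} (hM : ∀ s, |w s| ≤ M)
    (hf : Measurable f) {F : ℝ} (hF : ∀ s, |f s| ≤ F)
    (h : ∀ s, w s = f s + γ * ∫ a, ∫ s', w s' ∂(T (s, a)) ∂(π s)) :
    ∫ s, w s ∂D = (1 - γ)⁻¹ * ∫ s, f s ∂(discVisit γ (stateLaw T π D)) := by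
  rw [integral_discVisit h0 h1 _ hf hF, ← mul_assoc, inv_mul_cancel₀ (by linarith), one_mul,
    (hasSum_of_poisson h0 h1 D hw hM hf hF h).tsum_eq]

theorem ae_ctrlStep (hR : Measurable R) (hB : ∀ s, ∀ᵐ a ∂(π s), |R (s, a)| ≤ B) (x : S × A) :
    ∀ᵐ y ∂(ctrlStep T π x), |R y| ≤ B := by
  have hm : MeasurableSet {y | |R y| ≤ B} := measurableSet_le (by fun_prop) (by fun_prop)
  rw [ctrlStep_apply]
  exact Measure.ae_compProd_of_ae_ae hm (.of_forall hB)

theorem ae_compProd_policy (hR : Measurable R) (hB : ∀ s, ∀ᵐ a ∂(π s), |R (s, a)| ≤ B)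
    (D : Measure S) : ∀ᵐ y ∂(D ⊗ₘ π), |R y| ≤ B := by
  have hm : MeasurableSet {y | |R y| ≤ B} := measurableSet_le (by fun_prop) (by fun_prop)
  exact Measure.ae_compProd_of_ae_ae hm (.of_forall hB)

theorem measurable_ctrlValue (hR : Measurable R) (h0 : 0 ≤ γ) (h1 : γ < 1)
    (hB : ∀ s, ∀ᵐ a ∂(π s), |R (s, a)| ≤ B) : Measurable (ctrlValue T π γ R) :=
  measurable_integral_policy (measurable_discSum hR h0 h1 (ae_ctrlStep hR hB))

theorem abs_ctrlValue_le (hR : Measurable R) (h0 : 0 ≤ γ) (h1 : γ < 1)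
    (hB : ∀ s, ∀ᵐ a ∂(π s), |R (s, a)| ≤ B) (s : S) :
    |ctrlValue T π γ R s| ≤ (1 - γ)⁻¹ * B :=
  abs_integral_le_of_ae ((hB s).mono fun _ ha =>
    abs_discSum_le hR h0 h1 (ae_ctrlStep hR hB) ha)

theorem discSum_ctrlStep_eq (hR : Measurable R) (h0 : 0 ≤ γ) (h1 : γ < 1)
    (hB : ∀ s, ∀ᵐ a ∂(π s), |R (s, a)| ≤ B) (x : S × A) :
    discSum (ctrlStep T π) γ R x = R x + γ * ∫ s, ctrlValue T π γ R s ∂(T x) := by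
  rw [discSum_eq hR h0 h1 (ae_ctrlStep hR hB)]
  congr 2
  have hi : Integrable (discSum (ctrlStep T π) γ R) (ctrlStep T π x) :=
    integrable_of_ae_abs_le (measurable_discSum hR h0 h1 (ae_ctrlStep hR hB))
      (ae_abs_discSum_le hR h0 h1 (ae_ctrlStep hR hB) (ae_ctrlStep hR hB x))
  rw [ctrlStep_apply] at hi ⊢
  exact Measure.integral_compProd hi

/-- One step is played with `π'` and all later ones with `π`. For `π' = π` this is the Bellman
equation of the value; for `π' ≠ π` it evaluates a one-step deviation. -/
theorem integral_discSum_policy (hR : Measurable R) (h0 : 0 ≤ γ) (h1 : γ < 1)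
    (hB : ∀ s, ∀ᵐ a ∂(π s), |R (s, a)| ≤ B) {π' : Kernel S A} [IsMarkovKernel π']
    (hB' : ∀ s, ∀ᵐ a ∂(π' s), |R (s, a)| ≤ B) (s : S) :
    ∫ a, discSum (ctrlStep T π) γ R (s, a) ∂(π' s) =
      ∫ a, R (s, a) ∂(π' s) + γ * ∫ a, ∫ s', ctrlValue T π γ R s' ∂(T (s, a)) ∂(π' s) := by
  simp_rw [discSum_ctrlStep_eq hR h0 h1 hB]
  rw [integral_add, integral_const_mul]
  · exact integrable_of_ae_abs_le (hR.comp measurable_prodMk_left) (hB' s)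
  · refine Integrable.const_mul (Integrable.of_bound (C := (1 - γ)⁻¹ * B) ?_
      (.of_forall fun a => ?_)) _
    · exact ((measurable_integral_transition (T := T)
        (measurable_ctrlValue hR h0 h1 hB)).comp measurable_prodMk_left).aestronglyMeasurable
    · exact abs_integral_le_of_ae (.of_forall (abs_ctrlValue_le hR h0 h1 hB))

end Control

/-! ### The policy gradient for a controlled chain -/

section Gradient

variable {S A : Type*} [MeasurableSpace S] [MeasurableSpace A]
  {T : Kernel (S × A) S} [IsMarkovKernel T] {γ : ℝ} {R : S × A → ℝ} {B L ε : ℝ}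
  {E : Type*} [NormedAddCommGroup E] [NormedSpace ℝ E]

open Metric in
/-- The policy gradient theorem for a controlled Markov chain: if the rewards and the transition
law, averaged over the actions, are locally Lipschitz in the policy parameter, the gradient of the
return is the average of the gradients of the one-step improvements. -/
theorem hasFDerivAt_return (h0 : 0 ≤ γ) (h1 : γ < 1) (π : E → Kernel S A)
    [∀ ϑ, IsMarkovKernel (π ϑ)] (θ : E) (D : Measure S) [IsProbabilityMeasure D]
    (hR : Measurable R) (hε : 0 < ε)
    (hB : ∀ ϑ ∈ ball θ ε, ∀ s, ∀ᵐ a ∂(π ϑ s), |R (s, a)| ≤ B)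
    (hRL : ∀ ϑ ∈ ball θ ε, ∀ s,
      |∫ a, R (s, a) ∂(π ϑ s) - ∫ a, R (s, a) ∂(π θ s)| ≤ L * ‖ϑ - θ‖)
    (hTL : ∀ w : S → ℝ, Measurable w → ∀ M, (∀ s, |w s| ≤ M) → ∀ ϑ ∈ ball θ ε, ∀ s,
      |∫ a, ∫ s', w s' ∂(T (s, a)) ∂(π ϑ s) - ∫ a, ∫ s', w s' ∂(T (s, a)) ∂(π θ s)|
        ≤ L * M * ‖ϑ - θ‖)
    {G : S → E →L[ℝ] ℝ}
    (hG : AEStronglyMeasurable G (discVisit γ (stateLaw T (π θ) D)))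
    (hd : ∀ s, HasFDerivAt (fun ϑ => ∫ a, discSum (ctrlStep T (π θ)) γ R (s, a) ∂(π ϑ s))
      (G s) θ) :
    Integrable G (discVisit γ (stateLaw T (π θ) D)) ∧
      HasFDerivAt (fun ϑ => ∫ s, ctrlValue T (π ϑ) γ R s ∂D)
        ((1 - γ)⁻¹ • ∫ s, G s ∂(discVisit γ (stateLaw T (π θ) D))) θ := by
  have hθ : θ ∈ ball θ ε := mem_ball_self hε
  have hvis := isProbabilityMeasure_discVisit h0 h1 (stateLaw T (π θ) D)
  set d := discVisit γ (stateLaw T (π θ) D) with hdd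
  set V : E → S → ℝ := fun ϑ => ctrlValue T (π ϑ) γ R with hV
  set q := discSum (ctrlStep T (π θ)) γ R with hq
  set W := (1 - γ)⁻¹ * B with hW
  have hVm : ∀ ϑ ∈ ball θ ε, Measurable (V ϑ) := fun ϑ hϑ =>
    measurable_ctrlValue hR h0 h1 (hB ϑ hϑ)
  have hVb : ∀ ϑ ∈ ball θ ε, ∀ s, |V ϑ s| ≤ W := fun ϑ hϑ =>
    abs_ctrlValue_le hR h0 h1 (hB ϑ hϑ)
  have hqm : Measurable q := measurable_discSum hR h0 h1 (ae_ctrlStep hR (hB θ hθ))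
  have hqi : ∀ ϑ ∈ ball θ ε, ∀ s, ∫ a, q (s, a) ∂(π ϑ s) = ∫ a, R (s, a) ∂(π ϑ s) +
      γ * ∫ a, ∫ s', V θ s' ∂(T (s, a)) ∂(π ϑ s) := fun ϑ hϑ s =>
    integral_discSum_policy hR h0 h1 (hB θ hθ) (hB ϑ hϑ) s
  have hVi : ∀ ϑ ∈ ball θ ε, ∀ s, V ϑ s = ∫ a, R (s, a) ∂(π ϑ s) +
      γ * ∫ a, ∫ s', V ϑ s' ∂(T (s, a)) ∂(π ϑ s) := fun ϑ hϑ s =>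
    integral_discSum_policy hR h0 h1 (hB ϑ hϑ) (hB ϑ hϑ) s
  -- `a1` is the effect of deviating for one step with the critic frozen at `θ`. In `a2` the change
  -- of policy meets the change of value, a product of two small quantities.
  set a1 : E → S → ℝ := fun ϑ s => ∫ a, q (s, a) ∂(π ϑ s) - ∫ a, q (s, a) ∂(π θ s) with ha1
  set a2 : E → S → ℝ := fun ϑ s => ∫ a, ∫ s', (V ϑ s' - V θ s') ∂(T (s, a)) ∂(π ϑ s) -
    ∫ a, ∫ s', (V ϑ s' - V θ s') ∂(T (s, a)) ∂(π θ s) with ha2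
  have hwm : ∀ ϑ ∈ ball θ ε, Measurable (fun s => V ϑ s - V θ s) := fun ϑ hϑ =>
    (hVm ϑ hϑ).sub (hVm θ hθ)
  have hwb : ∀ ϑ ∈ ball θ ε, ∀ s, |V ϑ s - V θ s| ≤ 2 * W := fun ϑ hϑ s => by
    have := abs_sub (V ϑ s) (V θ s)
    linarith [hVb ϑ hϑ s, hVb θ hθ s]
  have ha1m : ∀ ϑ, Measurable (a1 ϑ) := fun ϑ =>
    (measurable_integral_policy hqm).sub (measurable_integral_policy hqm)
  have ha2m : ∀ ϑ ∈ ball θ ε, Measurable (a2 ϑ) := fun ϑ hϑ =>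
    (measurable_integral_policy (measurable_integral_transition (hwm ϑ hϑ))).sub
      (measurable_integral_policy (measurable_integral_transition (hwm ϑ hϑ)))
  have ha1b : ∀ ϑ ∈ ball θ ε, ∀ s, |a1 ϑ s| ≤ (L + γ * (L * W)) * ‖ϑ - θ‖ := by
    intro ϑ hϑ s
    simp only [ha1]
    rw [hqi ϑ hϑ, hqi θ hθ, add_sub_add_comm, ← mul_sub]
    refine (abs_add_le _ _).trans ?_
    rw [abs_mul, abs_of_nonneg h0, add_mul, mul_assoc γ]
    exact add_le_add (hRL ϑ hϑ s)
      (mul_le_mul_of_nonneg_left (hTL _ (hVm θ hθ) _ (hVb θ hθ) ϑ hϑ s) h0)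
  have hPi : ∀ ϑ' ∈ ball θ ε, ∀ (ϑ : E) (s : S),
      Integrable (fun a => ∫ s', V ϑ' s' ∂(T (s, a))) (π ϑ s) := by
    intro ϑ' hϑ' ϑ s
    refine Integrable.of_bound (C := W) ?_ (.of_forall fun a => ?_)
    · exact ((measurable_integral_transition (T := T)
        (hVm ϑ' hϑ')).comp measurable_prodMk_left).aestronglyMeasurable
    · exact abs_integral_le_of_ae (.of_forall (hVb ϑ' hϑ'))
  have hVint : ∀ ϑ' ∈ ball θ ε, ∀ x, Integrable (V ϑ') (T x) := fun ϑ' hϑ' x =>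
    Integrable.of_bound (hVm ϑ' hϑ').aestronglyMeasurable W (.of_forall (hVb ϑ' hϑ'))
  have hsub : ∀ ϑ ∈ ball θ ε, ∀ (ϑ' : E) (s : S),
      ∫ a, ∫ s', (V ϑ s' - V θ s') ∂(T (s, a)) ∂(π ϑ' s) =
        ∫ a, ∫ s', V ϑ s' ∂(T (s, a)) ∂(π ϑ' s) -
          ∫ a, ∫ s', V θ s' ∂(T (s, a)) ∂(π ϑ' s) := by
    intro ϑ hϑ ϑ' s
    rw [← integral_sub (hPi ϑ hϑ ϑ' s) (hPi θ hθ ϑ' s)]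
    refine integral_congr_ae (.of_forall fun a => ?_)
    exact integral_sub (hVint ϑ hϑ _) (hVint θ hθ _)
  -- The difference of the Bellman equations for `ϑ` and `θ`, arranged so that the last operator
  -- belongs to the fixed policy `π θ`; the occupation measure that appears is then independent of
  -- `ϑ`.
  have hpois : ∀ ϑ ∈ ball θ ε, ∀ s, V ϑ s - V θ s = (a1 ϑ s + γ * a2 ϑ s) +
      γ * ∫ a, ∫ s', (V ϑ s' - V θ s') ∂(T (s, a)) ∂(π θ s) := by
    intro ϑ hϑ s
    simp only [ha1, ha2]
    rw [hqi ϑ hϑ, hqi θ hθ, hVi ϑ hϑ s, hVi θ hθ s, hsub ϑ hϑ ϑ s]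
    ring
  have hfm : ∀ ϑ ∈ ball θ ε, Measurable (fun s => a1 ϑ s + γ * a2 ϑ s) := fun ϑ hϑ =>
    (ha1m ϑ).add ((ha2m ϑ hϑ).const_mul _)
  set C := (1 - γ)⁻¹ * (L + γ * (L * W) + γ * (L * (2 * W))) with hC
  have hfb : ∀ ϑ ∈ ball θ ε, ∀ s, |a1 ϑ s + γ * a2 ϑ s| ≤
      (L + γ * (L * W) + γ * (L * (2 * W))) * ‖ϑ - θ‖ := by
    intro ϑ hϑ s
    refine (abs_add_le _ _).trans ?_
    rw [abs_mul, abs_of_nonneg h0, add_mul _ (γ * (L * (2 * W))), mul_assoc γ]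
    exact add_le_add (ha1b ϑ hϑ s)
      (mul_le_mul_of_nonneg_left (hTL _ (hwm ϑ hϑ) _ (hwb ϑ hϑ) ϑ hϑ s) h0)
  -- Bootstrap: the crude bound `2 * W` makes the source linear in `‖ϑ - θ‖`, the Poisson equation
  -- passes this on to `V ϑ - V θ`, and inserting it again in `hTL` makes `a2` quadratic.
  have hwC : ∀ ϑ ∈ ball θ ε, ∀ s, |V ϑ s - V θ s| ≤ C * ‖ϑ - θ‖ := by
    intro ϑ hϑ s
    rw [hC, mul_assoc]
    exact abs_le_of_poisson h0 h1 (hwm ϑ hϑ) (hwb ϑ hϑ) (hfm ϑ hϑ) (hfb ϑ hϑ) (hpois ϑ hϑ) s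
  have ha2b : ∀ ϑ ∈ ball θ ε, ∀ s, |a2 ϑ s| ≤ L * C * ‖ϑ - θ‖ ^ 2 := by
    intro ϑ hϑ s
    refine (hTL _ (hwm ϑ hϑ) _ (hwC ϑ hϑ) ϑ hϑ s).trans (le_of_eq ?_)
    ring
  have hmain : ∀ ϑ ∈ ball θ ε, ∫ s, V ϑ s ∂D = ∫ s, V θ s ∂D +
      (1 - γ)⁻¹ * ((∫ s, a1 ϑ s ∂d) + γ * ∫ s, a2 ϑ s ∂d) := by
    intro ϑ hϑ
    have hVD : ∀ ϑ' ∈ ball θ ε, Integrable (V ϑ') D := fun ϑ' hϑ' =>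
      Integrable.of_bound (hVm ϑ' hϑ').aestronglyMeasurable W (.of_forall (hVb ϑ' hϑ'))
    have h := integral_of_poisson h0 h1 D (hwm ϑ hϑ) (hwb ϑ hϑ) (hfm ϑ hϑ) (hfb ϑ hϑ)
      (hpois ϑ hϑ)
    rw [integral_sub (hVD ϑ hϑ) (hVD θ hθ), ← hdd, integral_add, integral_const_mul] at h
    · rw [← h]; ring
    · exact Integrable.of_bound (ha1m ϑ).aestronglyMeasurable _ (.of_forall (ha1b ϑ hϑ))
    · exact (Integrable.of_bound (ha2m ϑ hϑ).aestronglyMeasurable _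
        (.of_forall (ha2b ϑ hϑ))).const_mul _
  have hd1 : Integrable G d ∧ HasFDerivAt (fun ϑ => ∫ s, a1 ϑ s ∂d) (∫ s, G s ∂d) θ := by
    refine hasFDerivAt_integral_of_dominated_loc_of_lip' (ball_mem_nhds θ hε)
      (bound := fun _ => L + γ * (L * W))
      (fun ϑ _ => (ha1m ϑ).aestronglyMeasurable) ?_ hG (.of_forall fun s ϑ hϑ => ?_)
      (integrable_const _) (.of_forall fun s => (hd s).sub_const _)
    · simp [ha1]
    · have : a1 θ s = 0 := by simp [ha1]
      rw [this, sub_zero]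
      exact ha1b ϑ hϑ s
  have hd2 : HasFDerivAt (fun ϑ => ∫ s, a2 ϑ s ∂d) (0 : E →L[ℝ] ℝ) θ := by
    have h00 : ∫ s, a2 θ s ∂d = 0 := by simp [ha2]
    rw [hasFDerivAt_iff_isLittleO_nhds_zero]
    simp only [h00, sub_zero, zero_apply]
    have : (fun h : E => ∫ s, a2 (θ + h) s ∂d) =O[nhds 0] (fun h => ‖h‖ ^ 2) := by
      refine Asymptotics.IsBigO.of_bound (L * C) ?_
      filter_upwards [ball_mem_nhds (0 : E) hε] with h hh
      have hh' : θ + h ∈ ball θ ε := by simpa using hh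
      have := abs_integral_le_of_ae (μ := d) (.of_forall (ha2b (θ + h) hh'))
      simpa using this
    refine this.trans_isLittleO ?_
    exact Asymptotics.isLittleO_norm_pow_id one_lt_two
  refine ⟨hd1.1, ?_⟩
  have h3 := (((hd1.2.add (hd2.const_mul γ)).const_mul (1 - γ)⁻¹).const_add (∫ s, V θ s ∂D))
  refine (h3.congr_fderiv (by simp)).congr_of_eventuallyEq ?_
  filter_upwards [ball_mem_nhds θ hε] with ϑ hϑ
  exact hmain ϑ hϑ

end Gradient

end MARL

/-! ### Marginals of product measures and extension of partial tuples -/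

namespace MARL

theorem pi_map_finset_restrict {ι : Type*} [Fintype ι] {Y : ι → Type*}
    [∀ i, MeasurableSpace (Y i)] (μ : ∀ i, Measure (Y i)) [∀ i, IsProbabilityMeasure (μ i)]
    (I : Finset ι) : (Measure.pi μ).map I.restrict = Measure.pi (fun i : I => μ i) := by
  rw [← Measure.infinitePi_eq_pi, Measure.infinitePi_map_restrict]

/-- Forgetting coordinates preserves the disintegration as soon as the law of what is kept of the
second component depends only on what is kept of the first. Both the dependency argument and the
passage to the local policy rest on this. -/
theorem map_prodMap_compProd {X Y X' Y' : Type*} [MeasurableSpace X] [MeasurableSpace Y]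
    [MeasurableSpace X'] [MeasurableSpace Y'] (μ : Measure X) [SFinite μ] (κ : Kernel X Y)
    [IsMarkovKernel κ] (κ' : Kernel X' Y') [IsMarkovKernel κ'] {f : X → X'} {g : Y → Y'}
    (hf : Measurable f) (hg : Measurable g) (h : ∀ x, κ' (f x) = (κ x).map g) :
    (μ ⊗ₘ κ).map (Prod.map f g) = μ.map f ⊗ₘ κ' := by
  ext s hs
  rw [Measure.map_apply (by fun_prop) hs, Measure.compProd_apply (hs.preimage (by fun_prop)),
    Measure.compProd_apply hs, lintegral_map (Kernel.measurable_kernel_prodMk_left hs) hf]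
  refine lintegral_congr fun x => ?_
  rw [h, Measure.map_apply hg (measurable_prodMk_left hs)]
  rfl

/-- Extension of a tuple indexed by a finset by the values of a default tuple. -/
def extendBy {V : Type*} [DecidableEq V] {S : V → Type*} (I : Finset V) (z : ∀ k, S k)
    (s : ∀ k : I, S k) (k : V) : S k := if h : k ∈ I then s ⟨k, h⟩ else z k

section ExtendBy

variable {V : Type*} [DecidableEq V] {S : V → Type*} (I : Finset V) (z : ∀ k, S k)

theorem extendBy_restrict (s : ∀ k, S k) {k : V} (h : k ∈ I) :
    extendBy I z (I.restrict s) k = s k := by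
  simp [extendBy, h]

theorem measurable_extendBy [∀ j, MeasurableSpace (S j)] : Measurable (extendBy I z) := by
  refine measurable_pi_lambda _ fun k => ?_
  by_cases h : k ∈ I
  · simp only [extendBy, h, dite_true]
    fun_prop
  · simp only [extendBy, h, dite_false]
    fun_prop

end ExtendBy

namespace Game

variable {V : Type*} [Fintype V] {S A : V → Type*}
  [∀ j, MeasurableSpace (S j)] [∀ j, MeasurableSpace (A j)] (G : Game V S A)

/-! ### The value functions as discounted sums -/

theorem measurable_reward (j : V) : Measurable (G.reward j) :=
  (G.measurable_r j).comp (by fun_prop)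

section Values

variable (κ : ∀ j, Kernel (G.Obs j) (A j)) [∀ j, IsMarkovKernel (κ j)] {B : ℝ}

/-- The sum of the rewards of all agents. -/
def totalReward (x : (∀ j, S j) × (∀ j, A j)) : ℝ := ∑ j, G.reward j x

theorem measurable_totalReward : Measurable G.totalReward :=
  Finset.measurable_sum _ fun j _ => G.measurable_reward j

variable {G κ}

theorem ae_totalReward (hB : ∀ j s, ∀ᵐ a ∂(G.globalPolicy κ s), |G.reward j (s, a)| ≤ B)
    (s : ∀ j, S j) :
    ∀ᵐ a ∂(G.globalPolicy κ s), |G.totalReward (s, a)| ≤ Fintype.card V * B := by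
  filter_upwards [ae_all_iff.2 fun j => hB j s] with a ha
  refine (Finset.abs_sum_le_sum_abs _ _).trans ?_
  simpa using Finset.sum_le_sum fun j (_ : j ∈ Finset.univ) => ha j

theorem Q_eq_discSum (hB : ∀ j s, ∀ᵐ a ∂(G.globalPolicy κ s), |G.reward j (s, a)| ≤ B)
    (j : V) (s : ∀ j, S j) (a : ∀ j, A j) :
    G.Q κ j s a = discSum (ctrlStep G.transition (G.globalPolicy κ)) G.γ (G.reward j) (s, a) :=
  integral_chainLaw_dirac (G.measurable_reward j) G.γ_nonneg G.γ_lt_one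
    (ae_ctrlStep (G.measurable_reward j) (hB j)) (s, a)

theorem sum_Q_eq_discSum (hB : ∀ j s, ∀ᵐ a ∂(G.globalPolicy κ s), |G.reward j (s, a)| ≤ B)
    (s : ∀ j, S j) (a : ∀ j, A j) :
    ∑ j, G.Q κ j s a =
      discSum (ctrlStep G.transition (G.globalPolicy κ)) G.γ G.totalReward (s, a) := by
  simp_rw [Q_eq_discSum hB]
  unfold discSum
  rw [← Summable.tsum_finsetSum fun j _ => summable_discSum (G.measurable_reward j) G.γ_nonneg
    G.γ_lt_one (ae_ctrlStep (G.measurable_reward j) (hB j)) (s, a)]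
  refine tsum_congr fun t => ?_
  rw [← Finset.mul_sum]
  congr 1
  unfold totalReward
  rw [integral_finsetSum]
  intro j _
  refine integrable_of_ae_abs_le (B := max B |G.reward j (s, a)|) (G.measurable_reward j) ?_
  exact ae_kernelIter (G.measurable_reward j)
    (fun x => (ae_ctrlStep (G.measurable_reward j) (hB j) x).mono
      fun y hy => hy.trans (le_max_left _ _)) (le_max_right _ _) t

theorem measurable_Q (hB : ∀ j s, ∀ᵐ a ∂(G.globalPolicy κ s), |G.reward j (s, a)| ≤ B)
    (j : V) : Measurable (fun x : (∀ j, S j) × (∀ j, A j) => G.Q κ j x.1 x.2) := by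
  simp_rw [Q_eq_discSum hB]
  exact measurable_discSum (G.measurable_reward j) G.γ_nonneg G.γ_lt_one
    (ae_ctrlStep (G.measurable_reward j) (hB j))

theorem value_eq_ctrlValue (hB : ∀ j s, ∀ᵐ a ∂(G.globalPolicy κ s), |G.reward j (s, a)| ≤ B)
    (s : ∀ j, S j) :
    G.value κ s = ctrlValue G.transition (G.globalPolicy κ) G.γ G.totalReward s := by
  have hR := G.measurable_totalReward
  have hae := ae_totalReward hB
  have h1 : G.value κ s = _ := integral_chainLaw hR G.γ_nonneg G.γ_lt_one
    (ae_ctrlStep (T := G.transition) hR hae) (Measure.dirac s ⊗ₘ G.globalPolicy κ)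
    (ae_compProd_policy hR hae _)
  have hm := measurable_discSum hR G.γ_nonneg G.γ_lt_one (ae_ctrlStep (T := G.transition) hR hae)
  rw [h1, Measure.integral_compProd, integral_dirac']
  · rfl
  · exact (measurable_integral_policy hm).stronglyMeasurable
  · exact integrable_of_ae_abs_le hm (ae_abs_discSum_le hR G.γ_nonneg G.γ_lt_one
      (ae_ctrlStep hR hae) (ae_compProd_policy hR hae _))

theorem visitation_eq_discVisit (D : Measure (∀ j, S j)) [IsProbabilityMeasure D] :
    G.visitation κ D = discVisit G.γ (stateLaw G.transition (G.globalPolicy κ) D) := by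
  unfold visitation discVisit
  congr 2
  funext t
  congr 1
  rw [stateLaw, Measure.fst]
  refine Eq.trans ?_ (congrArg (Measure.map Prod.fst)
    (map_eval_chainLaw (ctrlStep G.transition (G.globalPolicy κ)) _ t))
  rw [Measure.map_map (by fun_prop) (by fun_prop)]
  rfl

instance (D : Measure (∀ j, S j)) [IsProbabilityMeasure D] :
    IsProbabilityMeasure (G.visitation κ D) := by
  rw [visitation_eq_discVisit]
  exact isProbabilityMeasure_discVisit G.γ_nonneg G.γ_lt_one _

instance (D : Measure (∀ j, S j)) [IsProbabilityMeasure D] (i : V) :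
    IsProbabilityMeasure (G.visitationLoc κ D i) :=
  Measure.isProbabilityMeasure_map (by fun_prop)

instance (i : V) : IsMarkovKernel (G.policyLoc κ i) := by
  unfold policyLoc; infer_instance

theorem policyLoc_restrict (i : V) (s : ∀ j, S j) :
    G.policyLoc κ i ((G.Iqhat i).restrict s) =
      (G.globalPolicy κ s).map (G.Iqhat i).restrict :=
  (pi_map_finset_restrict (fun j => κ j ((G.Iobs j).restrict s)) (G.Iqhat i)).symm

/-- The agents in `Iqhat i` observe only one another, so their local policy is the marginal of the
global one. This carries the gradient formula from global to local averages. -/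
theorem visitationLoc_compProd (D : Measure (∀ j, S j)) [IsProbabilityMeasure D] (i : V) :
    G.visitationLoc κ D i ⊗ₘ G.policyLoc κ i =
      (G.visitation κ D ⊗ₘ G.globalPolicy κ).map
        (Prod.map (G.Iqhat i).restrict (G.Iqhat i).restrict) :=
  (map_prodMap_compProd _ _ _ (by fun_prop) (by fun_prop) (policyLoc_restrict i)).symm

end Values

/-! ### Value dependency -/

section Dependency

variable (κ : ∀ j, Kernel (G.Obs j) (A j)) [∀ j, IsMarkovKernel (κ j)] {B : ℝ}

/-- `I` contains the agents whose states or actions influence the next states and actions of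
the agents in `I`. -/
def IsDepClosed (I : Finset V) : Prop := ∀ l ∈ I, nbrs G.ES l ⊆ I ∧ G.Iobs l ⊆ I

/-- Two global states and actions agree on the agents in `I`. -/
def AgreeOn (I : Finset V) (x y : (∀ j, S j) × (∀ j, A j)) : Prop :=
  ∀ k ∈ I, x.1 k = y.1 k ∧ x.2 k = y.2 k

/-- The recursion for `U` adds, for each agent already present, the observation sets of its state
neighbours. Since every agent is its own neighbour in every graph, this includes the state
neighbours themselves and the agent's own observation set. -/
theorem isDepClosed_Iq (j : V) : G.IsDepClosed (G.Iq j) := by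
  classical
  intro l hl
  simp only [Iq, Finset.mem_filter, Finset.mem_univ, true_and] at hl
  obtain ⟨n, hn⟩ := hl
  have key : ∀ k ∈ nbrs G.ES l, G.Iobs k ⊆ G.Iq j := by
    intro k hk m hm
    simp only [Iq, Finset.mem_filter, Finset.mem_univ, true_and]
    exact ⟨n + 1, Finset.mem_union_right _
      (Finset.mem_biUnion.2 ⟨l, hn, Finset.mem_biUnion.2 ⟨k, hk, hm⟩⟩)⟩
  exact ⟨fun k hk => key k hk (self_mem_nbrs _ k), key l (self_mem_nbrs _ l)⟩

theorem nbrs_ER_subset_Iq (j : V) : nbrs G.ER j ⊆ G.Iq j := by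
  classical
  intro k hk
  simp only [Iq, Finset.mem_filter, Finset.mem_univ, true_and]
  exact ⟨0, Finset.mem_biUnion.2 ⟨k, hk, self_mem_nbrs _ k⟩⟩

variable {G}

theorem restrict_eq_of_agreeOn {I J : Finset V} (hJ : J ⊆ I)
    {x y : (∀ j, S j) × (∀ j, A j)} (h : AgreeOn I x y) :
    J.restrict x.1 = J.restrict y.1 ∧ J.restrict x.2 = J.restrict y.2 :=
  ⟨funext fun k => (h k (hJ k.2)).1, funext fun k => (h k (hJ k.2)).2⟩

/-- The marginal on `I` of a product measure is the product of the factors in `I`, and by closedness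
each of these reads only coordinates in `I`. -/
theorem map_restrict_transition_eq {I : Finset V} (hI : G.IsDepClosed I)
    {x y : (∀ j, S j) × (∀ j, A j)} (h : AgreeOn I x y) :
    (G.transition x).map I.restrict = (G.transition y).map I.restrict := by
  have hz : ∀ z, (G.transition z).map I.restrict = Measure.pi (fun l : I => G.P l
      ((nbrs G.ES l).restrict z.1, (nbrs G.ES l).restrict z.2)) := fun z =>
    pi_map_finset_restrict (fun l => G.P l
      ((nbrs G.ES l).restrict z.1, (nbrs G.ES l).restrict z.2)) I
  rw [hz, hz]
  congr 1
  funext l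
  obtain ⟨h1, h2⟩ := restrict_eq_of_agreeOn (hI l l.2).1 h
  rw [h1, h2]

theorem map_restrict_globalPolicy_eq {I : Finset V} (hI : G.IsDepClosed I)
    {s t : ∀ j, S j} (h : ∀ k ∈ I, s k = t k) :
    (G.globalPolicy κ s).map I.restrict = (G.globalPolicy κ t).map I.restrict := by
  have hz : ∀ s, (G.globalPolicy κ s).map I.restrict =
      Measure.pi (fun l : I => κ l ((G.Iobs l).restrict s)) := fun s =>
    pi_map_finset_restrict (fun l => κ l ((G.Iobs l).restrict s)) I
  rw [hz, hz]
  congr 1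
  funext l
  congr 1
  funext k
  exact h k ((hI l l.2).2 k.2)

variable [DecidableEq V]

theorem map_restrict_step_eq (zs : ∀ k, S k) {I : Finset V} (hI : G.IsDepClosed I)
    {x y : (∀ j, S j) × (∀ j, A j)} (h : AgreeOn I x y) :
    (ctrlStep G.transition (G.globalPolicy κ) x).map (Prod.map I.restrict I.restrict) =
      (ctrlStep G.transition (G.globalPolicy κ) y).map (Prod.map I.restrict I.restrict) := by
  have := Kernel.IsMarkovKernel.map (G.globalPolicy κ)
    (f := (I.restrict : (∀ j, A j) → _)) (by fun_prop)
  -- The policy on `I` becomes a kernel on partial states by filling the missing states from `zs`;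
  -- closedness of `I` makes the filling immaterial.
  have hz : ∀ s, (((G.globalPolicy κ).map I.restrict).comap (extendBy I zs)
      (measurable_extendBy I zs)) (I.restrict s) = (G.globalPolicy κ s).map I.restrict := by
    intro s
    rw [Kernel.comap_apply, Kernel.map_apply _ (by fun_prop)]
    exact map_restrict_globalPolicy_eq κ hI fun k hk => extendBy_restrict I zs s hk
  rw [ctrlStep_apply, ctrlStep_apply,
    map_prodMap_compProd _ _ _ (by fun_prop) (by fun_prop) hz,
    map_prodMap_compProd _ _ _ (by fun_prop) (by fun_prop) hz,
    map_restrict_transition_eq hI h]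

theorem integral_step_eq (zs : ∀ k, S k) (za : ∀ k, A k) {I : Finset V} (hI : G.IsDepClosed I)
    {f : (∀ j, S j) × (∀ j, A j) → ℝ} (hf : Measurable f)
    (hdep : ∀ x y, AgreeOn I x y → f x = f y)
    {x y : (∀ j, S j) × (∀ j, A j)} (h : AgreeOn I x y) :
    ∫ z, f z ∂(ctrlStep G.transition (G.globalPolicy κ) x) =
      ∫ z, f z ∂(ctrlStep G.transition (G.globalPolicy κ) y) := by
  have hz : ∀ x, ∫ z, f z ∂(ctrlStep G.transition (G.globalPolicy κ) x) =
      ∫ u, f (extendBy I zs u.1, extendBy I za u.2)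
        ∂((ctrlStep G.transition (G.globalPolicy κ) x).map
          (Prod.map I.restrict I.restrict)) := by
    intro x
    rw [integral_map (by fun_prop)]
    · refine integral_congr_ae (.of_forall fun z => hdep _ _ fun k hk => ?_)
      exact ⟨(extendBy_restrict I zs z.1 hk).symm, (extendBy_restrict I za z.2 hk).symm⟩
    · exact (hf.comp (((measurable_extendBy I zs).comp measurable_fst).prodMk
        ((measurable_extendBy I za).comp measurable_snd))).aestronglyMeasurable
  rw [hz, hz, map_restrict_step_eq κ zs hI h]

variable {κ}

/-- Induction on `t`, conditioning on the first step: by hypothesis the expectation of `f` after `t`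
steps is again a function of the coordinates in `I`, and one more step preserves this property. -/
theorem integral_kernelIter_eq (zs : ∀ k, S k) (za : ∀ k, A k) {I : Finset V}
    (hI : G.IsDepClosed I) {f : (∀ j, S j) × (∀ j, A j) → ℝ} (hf : Measurable f)
    (hB : ∀ s, ∀ᵐ a ∂(G.globalPolicy κ s), |f (s, a)| ≤ B)
    (hdep : ∀ x y, AgreeOn I x y → f x = f y) (t : ℕ)
    {x y : (∀ j, S j) × (∀ j, A j)} (h : AgreeOn I x y) :
    ∫ z, f z ∂(kernelIter (ctrlStep G.transition (G.globalPolicy κ)) t x) =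
      ∫ z, f z ∂(kernelIter (ctrlStep G.transition (G.globalPolicy κ)) t y) := by
  induction t generalizing x y with
  | zero =>
    simp only [kernelIter, Kernel.id_apply, integral_dirac' _ _ hf.stronglyMeasurable]
    exact hdep x y h
  | succ t ih =>
    have hi : ∀ x, Integrable f (kernelIter (ctrlStep G.transition (G.globalPolicy κ)) t ∘ₘ
        ctrlStep G.transition (G.globalPolicy κ) x) := fun x =>
      integrable_of_ae_abs_le hf (ae_kernelIter_comp hf (ae_ctrlStep hf hB)
        (ae_ctrlStep hf hB x) t)
    rw [kernelIter_succ_apply, kernelIter_succ_apply, integral_measure_comp (hi x),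
      integral_measure_comp (hi y)]
    exact integral_step_eq κ zs za hI
      (hf.stronglyMeasurable.integral_kernel (κ := kernelIter _ t)).measurable
      (fun x y hxy => ih hxy) h

/-- The local critic of agent `j` depends on the states and actions of the agents in the value
dependency set only. -/
theorem Q_eq_of_agreeOn (hB : ∀ j s, ∀ᵐ a ∂(G.globalPolicy κ s), |G.reward j (s, a)| ≤ B)
    (j : V) {x y : (∀ j, S j) × (∀ j, A j)} (h : AgreeOn (G.Iq j) x y) :
    G.Q κ j x.1 x.2 = G.Q κ j y.1 y.2 := by
  rw [Q_eq_discSum hB, Q_eq_discSum hB]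
  refine tsum_congr fun t => ?_
  congr 1
  refine integral_kernelIter_eq x.1 x.2 (G.isDepClosed_Iq j) (G.measurable_reward j) (hB j)
    (fun x y hxy => ?_) t h
  obtain ⟨h1, h2⟩ := restrict_eq_of_agreeOn (G.nbrs_ER_subset_Iq j) hxy
  rw [reward, reward, h1, h2]

variable (G κ) in
/-- The local critics as functions of the states and actions of the agents in the value
dependency sets. -/
def localCritic (zs : ∀ k, S k) (za : ∀ k, A k) (j : V) (s : ∀ k : G.Iq j, S k)
    (a : ∀ k : G.Iq j, A k) : ℝ :=
  G.Q κ j (extendBy (G.Iq j) zs s) (extendBy (G.Iq j) za a)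

theorem isLocalCritic_localCritic
    (hB : ∀ j s, ∀ᵐ a ∂(G.globalPolicy κ s), |G.reward j (s, a)| ≤ B)
    (zs : ∀ k, S k) (za : ∀ k, A k) : G.IsLocalCritic κ (G.localCritic κ zs za) := by
  intro j s a
  exact Q_eq_of_agreeOn hB j (x := (s, a))
    (y := (extendBy (G.Iq j) zs ((G.Iq j).restrict s), extendBy (G.Iq j) za ((G.Iq j).restrict a)))
    fun k hk => ⟨(extendBy_restrict _ zs s hk).symm, (extendBy_restrict _ za a hk).symm⟩

theorem truncCritic_restrict
    {q : ∀ j, (∀ k : G.Iq j, S k) → (∀ k : G.Iq j, A k) → ℝ} (hq : G.IsLocalCritic κ q)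
    (i : V) (s : ∀ j, S j) (a : ∀ j, A j) :
    G.truncCritic q i ((G.Iqhat i).restrict s) ((G.Iqhat i).restrict a) =
      ∑ j ∈ G.Igd i, G.Q κ j s a := by
  rw [truncCritic, ← Finset.sum_coe_sort (G.Igd i)]
  refine Finset.sum_congr rfl fun j _ => ?_
  rw [hq]
  rfl

/-- The critics outside the gradient dependency set of agent `i` ignore the action of `i`. -/
theorem sum_Q_update (hB : ∀ j s, ∀ᵐ a ∂(G.globalPolicy κ s), |G.reward j (s, a)| ≤ B)
    {q : ∀ j, (∀ k : G.Iq j, S k) → (∀ k : G.Iq j, A k) → ℝ} (hq : G.IsLocalCritic κ q)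
    (i : V) (s : ∀ j, S j) (a : ∀ j, A j) (b : A i) :
    ∑ j, G.Q κ j s (Function.update a i b) =
      G.truncCritic q i ((G.Iqhat i).restrict s)
        ((G.Iqhat i).restrict (Function.update a i b)) +
      ∑ j ∈ (G.Igd i)ᶜ, G.Q κ j s a := by
  rw [truncCritic_restrict hq, ← Finset.sum_add_sum_compl (G.Igd i)]
  congr 1
  refine Finset.sum_congr rfl fun j hj => ?_
  refine Q_eq_of_agreeOn hB j (x := (s, Function.update a i b)) (y := (s, a)) fun k hk => ⟨rfl, ?_⟩
  -- If `i` were in `Iq j`, then `j` would belong to `Igd i`.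
  have hki : k ≠ i := by
    rintro rfl
    exact (Finset.mem_compl.1 hj) (by simp [Igd, hk])
  simp [hki]

end Dependency

end Game

end MARL

namespace MARL

/-! ### Gradients under the integral sign, by Riesz duality -/

section GradientIntegral

variable {α : Type*} [MeasurableSpace α] {μ : Measure α} {n : ℕ}

theorem toDual_eq_innerSL (x : EuclideanSpace ℝ (Fin n)) :
    InnerProductSpace.toDual ℝ (EuclideanSpace ℝ (Fin n)) x = innerSL ℝ x := rfl

theorem integral_toDual {g : α → EuclideanSpace ℝ (Fin n)} (hg : Integrable g μ) :
    ∫ a, InnerProductSpace.toDual ℝ (EuclideanSpace ℝ (Fin n)) (g a) ∂μ =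
      InnerProductSpace.toDual ℝ (EuclideanSpace ℝ (Fin n)) (∫ a, g a ∂μ) := by
  simp_rw [toDual_eq_innerSL]
  exact ContinuousLinearMap.integral_comp_comm (innerSL ℝ) hg

theorem aestronglyMeasurable_toDual {g : α → EuclideanSpace ℝ (Fin n)} (hg : AEStronglyMeasurable g μ) :
    AEStronglyMeasurable (fun a => InnerProductSpace.toDual ℝ (EuclideanSpace ℝ (Fin n)) (g a)) μ :=
  (innerSL ℝ (E := EuclideanSpace ℝ (Fin n))).continuous.comp_aestronglyMeasurable hg

theorem integrable_of_toDual {g : α → EuclideanSpace ℝ (Fin n)} (hg : AEStronglyMeasurable g μ)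
    (h : Integrable (fun a => InnerProductSpace.toDual ℝ (EuclideanSpace ℝ (Fin n)) (g a)) μ) : Integrable g μ := by
  refine (integrable_norm_iff hg).1 (h.norm.congr (.of_forall fun a => ?_))
  exact (InnerProductSpace.toDual ℝ (EuclideanSpace ℝ (Fin n))).norm_map (g a)

theorem hasGradientAt_integral {F : (EuclideanSpace ℝ (Fin n)) → α → ℝ} {F' : α → EuclideanSpace ℝ (Fin n)} {x₀ : EuclideanSpace ℝ (Fin n)} {s : Set (EuclideanSpace ℝ (Fin n))}
    {bound : α → ℝ} (hs : s ∈ nhds x₀)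
    (hF_meas : ∀ x ∈ s, AEStronglyMeasurable (F x) μ) (hF_int : Integrable (F x₀) μ)
    (hF'_meas : AEStronglyMeasurable F' μ)
    (h_lipsch : ∀ a, ∀ x ∈ s, ‖F x a - F x₀ a‖ ≤ bound a * ‖x - x₀‖)
    (bound_integrable : Integrable bound μ)
    (h_diff : ∀ a, HasGradientAt (F · a) (F' a) x₀) :
    HasGradientAt (fun x => ∫ a, F x a ∂μ) (∫ a, F' a ∂μ) x₀ := by
  have h := hasFDerivAt_integral_of_dominated_loc_of_lip' (𝕜 := ℝ) hs hF_meas hF_int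
    (aestronglyMeasurable_toDual hF'_meas) (.of_forall h_lipsch) bound_integrable
    (.of_forall fun a => (hasGradientAt_iff_hasFDerivAt.1 (h_diff a)))
  rw [hasGradientAt_iff_hasFDerivAt, ← integral_toDual (integrable_of_toDual hF'_meas h.1)]
  exact h.2

theorem _root_.HasGradientAt.add_const_right {f : (EuclideanSpace ℝ (Fin n)) → ℝ} {g x : EuclideanSpace ℝ (Fin n)}
    (h : HasGradientAt f g x) (c : ℝ) : HasGradientAt (fun y => f y + c) g x := by
  rw [hasGradientAt_iff_hasFDerivAt] at h ⊢
  exact h.add_const c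

end GradientIntegral

namespace Game

variable {V : Type*} [Fintype V] {S A : V → Type*}
  [∀ j, MeasurableSpace (S j)] [∀ j, MeasurableSpace (A j)] {G : Game V S A}

open Metric in
/-- The policy gradient theorem with the global state-action value function. -/
theorem hasGradientAt_expectedReturn {n : ℕ}
    (κ : EuclideanSpace ℝ (Fin n) → ∀ j, Kernel (G.Obs j) (A j))
    [∀ ϑ j, IsMarkovKernel (κ ϑ j)] (θ : EuclideanSpace ℝ (Fin n))
    (D : Measure (∀ j, S j)) [IsProbabilityMeasure D] {ε B L : ℝ} (hε : 0 < ε)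
    (hB : ∀ ϑ ∈ ball θ ε, ∀ j s, ∀ᵐ a ∂(G.globalPolicy (κ ϑ) s), |G.reward j (s, a)| ≤ B)
    (hRL : ∀ ϑ ∈ ball θ ε, ∀ s, |∫ a, G.totalReward (s, a) ∂(G.globalPolicy (κ ϑ) s) -
      ∫ a, G.totalReward (s, a) ∂(G.globalPolicy (κ θ) s)| ≤ L * ‖ϑ - θ‖)
    (hTL : ∀ w : (∀ j, S j) → ℝ, Measurable w → ∀ M, (∀ s, |w s| ≤ M) → ∀ ϑ ∈ ball θ ε, ∀ s,
      |∫ a, ∫ s', w s' ∂(G.transition (s, a)) ∂(G.globalPolicy (κ ϑ) s) -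
        ∫ a, ∫ s', w s' ∂(G.transition (s, a)) ∂(G.globalPolicy (κ θ) s)| ≤ L * M * ‖ϑ - θ‖)
    {g : (∀ j, S j) → EuclideanSpace ℝ (Fin n)}
    (hg : AEStronglyMeasurable g (G.visitation (κ θ) D))
    (hd : ∀ s, HasGradientAt
      (fun ϑ => ∫ a, ∑ j, G.Q (κ θ) j s a ∂(G.globalPolicy (κ ϑ) s)) (g s) θ) :
    Integrable g (G.visitation (κ θ) D) ∧
      HasGradientAt (fun ϑ => G.expectedReturn (κ ϑ) D)
        ((1 - G.γ)⁻¹ • ∫ s, g s ∂(G.visitation (κ θ) D)) θ := by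
  have hθ : θ ∈ ball θ ε := mem_ball_self hε
  simp_rw [sum_Q_eq_discSum (hB θ hθ), hasGradientAt_iff_hasFDerivAt] at hd
  have hg' := aestronglyMeasurable_toDual hg
  rw [visitation_eq_discVisit] at hg'
  have h := hasFDerivAt_return G.γ_nonneg G.γ_lt_one (fun ϑ => G.globalPolicy (κ ϑ)) θ D
    G.measurable_totalReward hε (fun ϑ hϑ => ae_totalReward (hB ϑ hϑ)) hRL hTL hg' hd
  rw [← visitation_eq_discVisit] at h
  have hi := integrable_of_toDual hg h.1
  refine ⟨hi, ?_⟩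
  rw [hasGradientAt_iff_hasFDerivAt, map_smulₛₗ, ← integral_toDual hi]
  refine h.2.congr_of_eventuallyEq ?_
  filter_upwards [ball_mem_nhds θ hε] with ϑ hϑ
  unfold expectedReturn
  simp_rw [value_eq_ctrlValue (hB ϑ hϑ)]

end Game

/-! ### Integrals against product measures with one changed factor -/

section PiUpdate

variable {ι : Type*} [Fintype ι] [DecidableEq ι] {Y : ι → Type*} [∀ i, MeasurableSpace (Y i)]

theorem measurable_update_prod (i : ι) :
    Measurable (fun p : (∀ i, Y i) × Y i => Function.update p.1 i p.2) :=
  measurable_update'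

/-- Resampling coordinate `i` from `m`. Rectangles suffice: the preimage of a rectangle leaves the
old coordinate `i` free, which contributes total mass `1`, and constrains the new one. -/
theorem map_update_prod (μ : ∀ i, Measure (Y i)) [∀ i, IsProbabilityMeasure (μ i)] (i : ι)
    (m : Measure (Y i)) [IsProbabilityMeasure m] :
    ((Measure.pi μ).prod m).map (fun p => Function.update p.1 i p.2) =
      Measure.pi (Function.update μ i m) := by
  have hp : ∀ j, IsProbabilityMeasure (Function.update μ i m j) := by
    intro j
    rcases eq_or_ne j i with rfl | h
    · simpa
    · simpa [h] using inferInstanceAs (IsProbabilityMeasure (μ j))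
  symm
  refine Measure.pi_eq fun s hs => ?_
  rw [Measure.map_apply (measurable_update_prod i) (MeasurableSet.univ_pi hs)]
  have : (fun p : (∀ i, Y i) × Y i => Function.update p.1 i p.2) ⁻¹' Set.univ.pi s =
      (Set.univ.pi (Function.update s i Set.univ)) ×ˢ s i := by
    ext ⟨a, b⟩
    simp only [Set.mem_preimage, Set.mem_univ_pi, Set.mem_prod]
    constructor
    · intro h
      refine ⟨fun j => ?_, by simpa using h i⟩
      rcases eq_or_ne j i with rfl | hj
      · simp
      · simpa [hj] using h j
    · rintro ⟨h, hb⟩ j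
      rcases eq_or_ne j i with rfl | hj
      · simpa
      · simpa [hj] using h j
  rw [this, Measure.prod_prod, Measure.pi_pi, ← Finset.prod_erase_mul _ _ (Finset.mem_univ i),
    ← Finset.prod_erase_mul (a := i) _ (fun j => Function.update μ i m j (s j))
      (Finset.mem_univ i)]
  simp only [Function.update_self, measure_univ, mul_one]
  congr 1
  refine Finset.prod_congr rfl fun j hj => ?_
  simp [Finset.ne_of_mem_erase hj]

/-- The inner integral does not involve `m`; a parameter entering through one factor is thereby
isolated in the outer integral. -/
theorem integral_pi_update {F : Type*} [NormedAddCommGroup F] [NormedSpace ℝ F]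
    (μ : ∀ i, Measure (Y i)) [∀ i, IsProbabilityMeasure (μ i)] (i : ι)
    (m : Measure (Y i)) [IsProbabilityMeasure m] {f : (∀ i, Y i) → F}
    (hf : Integrable f (Measure.pi (Function.update μ i m))) :
    ∫ a, f a ∂(Measure.pi (Function.update μ i m)) =
      ∫ b, ∫ a, f (Function.update a i b) ∂(Measure.pi μ) ∂m := by
  rw [← map_update_prod] at hf ⊢
  rw [integral_map (measurable_update_prod i).aemeasurable hf.aestronglyMeasurable,
    integral_prod_symm]
  exact (integrable_map_measure hf.aestronglyMeasurable
    (measurable_update_prod i).aemeasurable).1 hf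

theorem integral_pi_eq {F : Type*} [NormedAddCommGroup F] [NormedSpace ℝ F]
    (μ : ∀ i, Measure (Y i)) [∀ i, IsProbabilityMeasure (μ i)] (i : ι) {f : (∀ i, Y i) → F}
    (hf : Integrable f (Measure.pi μ)) :
    ∫ a, f a ∂(Measure.pi μ) = ∫ b, ∫ a, f (Function.update a i b) ∂(Measure.pi μ) ∂(μ i) := by
  have := integral_pi_update μ i (μ i) (f := f)
  rw [Function.update_eq_self] at this
  exact this hf

end PiUpdate

/-! ### Parameter derivatives of densities -/

namespace StochPolicy

variable {n : ℕ} {O A : Type*} [MeasurableSpace O] [MeasurableSpace A] {ν : Measure A}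
  (p : StochPolicy (EuclideanSpace ℝ (Fin n)) O A ν) {ϑ₀ : EuclideanSpace ℝ (Fin n)}

/-- The gradient of the density in the parameter. -/
def grad (ϑ : EuclideanSpace ℝ (Fin n)) (o : O) (a : A) : EuclideanSpace ℝ (Fin n) :=
  gradient (fun ϑ' => p.dens ϑ' o a) ϑ

/-- The gradient of the density in the parameter, divided by the density. -/
def score (ϑ : EuclideanSpace ℝ (Fin n)) (o : O) (a : A) : EuclideanSpace ℝ (Fin n) :=
  (p.dens ϑ o a)⁻¹ • p.grad ϑ o a

/-- The partial derivatives are pointwise limits of difference quotients with increments `1/m`. Each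
quotient involves two fixed parameters, so joint measurability in observation and action is enough.
-/
theorem measurable_grad
    (hd : ∀ o a, DifferentiableAt ℝ (fun ϑ' => p.dens ϑ' o a) ϑ₀) :
    Measurable (fun x : O × A => p.grad ϑ₀ x.1 x.2) := by
  have hcoord : Measurable (fun (x : O × A) (k : Fin n) => p.grad ϑ₀ x.1 x.2 k) := by
    refine measurable_pi_lambda _ fun k => ?_
    have hk : ∀ x : O × A, p.grad ϑ₀ x.1 x.2 k =
        fderiv ℝ (fun ϑ' => p.dens ϑ' x.1 x.2) ϑ₀ (EuclideanSpace.single k 1) := by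
      intro x
      rw [← InnerProductSpace.toDual_symm_apply, ← gradient, ← grad,
        EuclideanSpace.inner_single_right]
      simp
    simp_rw [hk]
    refine measurable_of_tendsto_metrizable (f := fun (m : ℕ) (x : O × A) =>
      (m : ℝ) • (p.dens (ϑ₀ + (m : ℝ)⁻¹ • EuclideanSpace.single k 1) x.1 x.2
        - p.dens ϑ₀ x.1 x.2)) (fun m => ?_) (tendsto_pi_nhds.2 fun x => ?_)
    · exact ((p.measurable_dens _).sub (p.measurable_dens _)).const_mul (m : ℝ)
    · refine (hd x.1 x.2).hasFDerivAt.lim _ (c := fun m : ℕ => (m : ℝ)) ?_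
      simpa using tendsto_natCast_atTop_atTop
  exact (WithLp.measurable_toLp 2 _).comp hcoord

theorem measurable_score
    (hd : ∀ o a, DifferentiableAt ℝ (fun ϑ' => p.dens ϑ' o a) ϑ₀) :
    Measurable (fun x : O × A => p.score ϑ₀ x.1 x.2) :=
  (p.measurable_dens ϑ₀).inv.smul (p.measurable_grad hd)

/-- A zero of a nonnegative function is a minimum. Hence density times score equals the gradient
even where the score is not a logarithmic derivative. -/
theorem grad_eq_zero {o : O} {a : A} (h : p.dens ϑ₀ o a = 0) : p.grad ϑ₀ o a = 0 := by
  have : IsLocalMin (fun ϑ' => p.dens ϑ' o a) ϑ₀ :=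
    .of_forall fun ϑ => by simpa [h] using p.dens_nonneg ϑ o a
  rw [grad, gradient, this.fderiv_eq_zero, map_zero]

theorem dens_smul_score (o : O) (a : A) :
    p.dens ϑ₀ o a • p.score ϑ₀ o a = p.grad ϑ₀ o a := by
  rcases eq_or_ne (p.dens ϑ₀ o a) 0 with h | h
  · rw [h, zero_smul, p.grad_eq_zero h]
  · rw [score, smul_smul, mul_inv_cancel₀ h, one_smul]

theorem gradient_log_dens (hd : ∀ o a, DifferentiableAt ℝ (fun ϑ' => p.dens ϑ' o a) ϑ₀)
    {o : O} {a : A} (h : p.dens ϑ₀ o a ≠ 0) :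
    gradient (fun ϑ => Real.log (p.dens ϑ o a)) ϑ₀ = p.score ϑ₀ o a := by
  rw [gradient, ((hd o a).hasFDerivAt.log h).fderiv, map_smulₛₗ]
  rfl

variable [SigmaFinite ν]

theorem kernel_apply (ϑ : EuclideanSpace ℝ (Fin n)) (o : O) :
    p.kernel ϑ o = ν.withDensity (fun a => ENNReal.ofReal (p.dens ϑ o a)) := by
  rw [kernel, Kernel.withDensity_apply _ (p.measurable_dens ϑ).ennreal_ofReal, Kernel.const_apply]

theorem measurable_ofReal_dens (ϑ : EuclideanSpace ℝ (Fin n)) (o : O) :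
    Measurable (fun a => ENNReal.ofReal (p.dens ϑ o a)) :=
  ((p.measurable_dens ϑ).comp measurable_prodMk_left).ennreal_ofReal

theorem ae_dens_ne_zero (ϑ : EuclideanSpace ℝ (Fin n)) (o : O) :
    ∀ᵐ a ∂(p.kernel ϑ o), p.dens ϑ o a ≠ 0 := by
  rw [kernel_apply, ae_withDensity_iff (p.measurable_ofReal_dens ϑ o)]
  refine .of_forall fun a ha h => ha ?_
  simp [h]

theorem integral_kernel {F : Type*} [NormedAddCommGroup F] [NormedSpace ℝ F]
    (ϑ : EuclideanSpace ℝ (Fin n)) (o : O) (f : A → F) :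
    ∫ a, f a ∂(p.kernel ϑ o) = ∫ a, p.dens ϑ o a • f a ∂ν := by
  rw [kernel_apply, integral_withDensity_eq_integral_toReal_smul (p.measurable_ofReal_dens ϑ o)
    (.of_forall fun _ => ENNReal.ofReal_lt_top)]
  simp_rw [ENNReal.toReal_ofReal (p.dens_nonneg ϑ o _)]

theorem integrable_kernel_iff {F : Type*} [NormedAddCommGroup F] [NormedSpace ℝ F]
    (ϑ : EuclideanSpace ℝ (Fin n)) (o : O) (f : A → F) :
    Integrable f (p.kernel ϑ o) ↔ Integrable (fun a => p.dens ϑ o a • f a) ν := by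
  rw [kernel_apply, integrable_withDensity_iff_integrable_smul' (p.measurable_ofReal_dens ϑ o)
    (.of_forall fun _ => ENNReal.ofReal_lt_top)]
  simp_rw [ENNReal.toReal_ofReal (p.dens_nonneg ϑ o _)]

variable {p}

theorem RegularAt.differentiableAt (hp : p.RegularAt ϑ₀) (o : O) (a : A) :
    DifferentiableAt ℝ (fun ϑ' => p.dens ϑ' o a) ϑ₀ := by
  obtain ⟨ε, hε, C, h⟩ := hp
  obtain ⟨g, -, -, hg⟩ := h o
  exact (hg ϑ₀ (Metric.mem_ball_self hε) a).1

/-- The mean value inequality on the convex ball turns the majorant of the gradient into a Lipschitz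
majorant of the density. -/
theorem RegularAt.exists_bound (hp : p.RegularAt ϑ₀) :
    ∃ ε > 0, ∃ C : ℝ, 0 ≤ C ∧ ∀ o, ∃ g : A → ℝ, Integrable g ν ∧ ∫ a, g a ∂ν ≤ C ∧
      (∀ a, ‖p.grad ϑ₀ o a‖ ≤ g a) ∧
      ∀ ϑ ∈ Metric.ball ϑ₀ ε, ∀ a, ‖p.dens ϑ o a - p.dens ϑ₀ o a‖ ≤ g a * ‖ϑ - ϑ₀‖ := by
  obtain ⟨ε, hε, C, h⟩ := hp
  refine ⟨ε, hε, max C 0, le_max_right _ _, fun o => ?_⟩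
  obtain ⟨g, hgi, hgC, hg⟩ := h o
  refine ⟨g, hgi, hgC.trans (le_max_left _ _),
    fun a => (hg ϑ₀ (Metric.mem_ball_self hε) a).2, fun ϑ hϑ a => ?_⟩
  refine (convex_ball ϑ₀ ε).norm_image_sub_le_of_norm_fderiv_le (𝕜 := ℝ)
    (fun ϑ' h' => (hg ϑ' h' a).1) (fun ϑ' h' => ?_) (Metric.mem_ball_self hε) hϑ
  have := (hg ϑ' h' a).2
  rwa [gradient, LinearIsometryEquiv.norm_map] at this

/-- Log-derivative trick: differentiate the density under the integral and write its gradient as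
density times score, which turns the result back into an average over the policy. The Lipschitz
bound is of total variation type, uniform in the observation and linear in the bound on the
integrand, as the controlled-chain theorem requires. -/
theorem RegularAt.exists_integral_bound (hp : p.RegularAt ϑ₀) :
    ∃ ε > 0, ∃ C : ℝ, 0 ≤ C ∧
      (∀ o, Integrable (p.score ϑ₀ o) (p.kernel ϑ₀ o) ∧
        ∫ a, ‖p.score ϑ₀ o a‖ ∂(p.kernel ϑ₀ o) ≤ C) ∧
      ∀ (h : A → ℝ) (M : ℝ), Measurable h → (∀ a, |h a| ≤ M) → ∀ o,
        HasGradientAt (fun ϑ => ∫ a, h a ∂(p.kernel ϑ o))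
          (∫ a, h a • p.score ϑ₀ o a ∂(p.kernel ϑ₀ o)) ϑ₀ ∧
        ∀ ϑ ∈ Metric.ball ϑ₀ ε,
          |∫ a, h a ∂(p.kernel ϑ o) - ∫ a, h a ∂(p.kernel ϑ₀ o)| ≤ C * M * ‖ϑ - ϑ₀‖ := by
  have hd := hp.differentiableAt
  obtain ⟨ε, hε, C, hC, hb⟩ := hp.exists_bound
  have hgm : ∀ o, Measurable (p.grad ϑ₀ o) := fun o =>
    (p.measurable_grad hd).comp measurable_prodMk_left
  have hdm : ∀ ϑ o, Measurable (p.dens ϑ o) := fun ϑ o =>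
    (p.measurable_dens ϑ).comp measurable_prodMk_left
  refine ⟨ε, hε, C, hC, fun o => ?_, fun h M hh hM o => ?_⟩
  · obtain ⟨g, hgi, hgC, hg, -⟩ := hb o
    have hi : Integrable (p.grad ϑ₀ o) ν :=
      hgi.mono' (hgm o).aestronglyMeasurable (.of_forall hg)
    constructor
    · rw [integrable_kernel_iff]
      simpa only [dens_smul_score] using hi
    · rw [integral_kernel]
      refine le_trans (integral_mono_ae (g := g) ?_ hgi (.of_forall fun a => ?_)) hgC
      · refine hi.norm.congr (.of_forall fun a => ?_)
        simp only
        rw [← p.dens_smul_score, norm_smul, Real.norm_of_nonneg (p.dens_nonneg _ _ _), smul_eq_mul]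
      · refine le_trans (le_of_eq ?_) (hg a)
        simp only
        rw [← p.dens_smul_score, norm_smul, Real.norm_of_nonneg (p.dens_nonneg _ _ _), smul_eq_mul]
  · obtain ⟨g, hgi, hgC, hg, hL⟩ := hb o
    have hint : ∀ ϑ, Integrable (fun a => p.dens ϑ o a • h a) ν := fun ϑ => by
      rw [← integrable_kernel_iff]
      exact Integrable.of_bound hh.aestronglyMeasurable M (.of_forall hM)
    have hlip : ∀ a, ∀ ϑ ∈ Metric.ball ϑ₀ ε,
        ‖p.dens ϑ o a • h a - p.dens ϑ₀ o a • h a‖ ≤ (g a * M) * ‖ϑ - ϑ₀‖ := by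
      intro a ϑ hϑ
      rw [← sub_smul, norm_smul, mul_right_comm]
      exact mul_le_mul (hL ϑ hϑ a) (hM a) (norm_nonneg _)
        ((norm_nonneg _).trans (hL ϑ hϑ a))
    simp_rw [integral_kernel]
    constructor
    · have : ∀ a, p.dens ϑ₀ o a • h a • p.score ϑ₀ o a = h a • p.grad ϑ₀ o a := fun a => by
        rw [smul_comm, dens_smul_score]
      simp_rw [this]
      refine hasGradientAt_integral (Metric.ball_mem_nhds ϑ₀ hε)
        (fun ϑ _ => (hint ϑ).aestronglyMeasurable) (hint ϑ₀)
        (hh.smul (hgm o)).aestronglyMeasurable hlip (hgi.mul_const M) fun a => ?_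
      have h1 := (hasGradientAt_iff_hasFDerivAt.1 (hd o a).hasGradientAt).mul_const (h a)
      rw [hasGradientAt_iff_hasFDerivAt, map_smulₛₗ]
      exact h1
    · intro ϑ hϑ
      rw [← integral_sub (hint ϑ) (hint ϑ₀)]
      refine (norm_integral_le_of_norm_le (G := ℝ) ((hgi.mul_const M).mul_const ‖ϑ - ϑ₀‖)
        (.of_forall fun a => hlip a ϑ hϑ)).trans ?_
      rw [integral_mul_const, integral_mul_const]
      -- An action is needed to know `0 ≤ M`; without actions the density could not have total mass
      -- `1`.
      rcases isEmpty_or_nonempty A with hA | ⟨⟨a⟩⟩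
      · have : ν = 0 := Measure.eq_zero_of_isEmpty ν
        have h1 := p.lintegral_dens ϑ₀ o
        simp [this] at h1
      · have hM0 : 0 ≤ M := (abs_nonneg _).trans (hM a)
        gcongr

end StochPolicy

end MARL

namespace MARL

namespace Game

/-! ### Measurability of the critics -/

section TruncCritic

variable {V : Type*} [Fintype V] [DecidableEq V] {S A : V → Type*}
  [∀ j, MeasurableSpace (S j)] [∀ j, MeasurableSpace (A j)] {G : Game V S A}
  {κ : ∀ j, Kernel (G.Obs j) (A j)} [∀ j, IsMarkovKernel (κ j)] {B : ℝ}

theorem measurable_localCritic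
    (hB : ∀ j s, ∀ᵐ a ∂(G.globalPolicy κ s), |G.reward j (s, a)| ≤ B)
    (zs : ∀ k, S k) (za : ∀ k, A k) (j : V) :
    Measurable (fun x : (∀ k : G.Iq j, S k) × (∀ k : G.Iq j, A k) =>
      G.localCritic κ zs za j x.1 x.2) := by
  have h : Measurable (fun x : (∀ k : G.Iq j, S k) × (∀ k : G.Iq j, A k) =>
      (extendBy (G.Iq j) zs x.1, extendBy (G.Iq j) za x.2)) :=
    ((measurable_extendBy _ zs).comp measurable_fst).prodMk
      ((measurable_extendBy _ za).comp measurable_snd)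
  have h2 := (measurable_Q hB j).comp h
  exact h2

theorem measurable_truncCritic {q : ∀ j, (∀ k : G.Iq j, S k) → (∀ k : G.Iq j, A k) → ℝ}
    (hq : ∀ j, Measurable (fun x : (∀ k : G.Iq j, S k) × (∀ k : G.Iq j, A k) => q j x.1 x.2))
    (i : V) : Measurable (fun x : (∀ k : G.Iqhat i, S k) × (∀ k : G.Iqhat i, A k) =>
      G.truncCritic q i x.1 x.2) := by
  refine Finset.measurable_sum _ fun j _ => ?_
  have h : Measurable (fun x : (∀ k : G.Iqhat i, S k) × (∀ k : G.Iqhat i, A k) =>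
      (Finset.restrict₂ (π := S) (G.Iq_subset_Iqhat j.2) x.1,
        Finset.restrict₂ (π := A) (G.Iq_subset_Iqhat j.2) x.2)) :=
    ((Finset.measurable_restrict₂ _).comp measurable_fst).prodMk
      ((Finset.measurable_restrict₂ _).comp measurable_snd)
  exact (hq j).comp h

theorem measurable_truncCritic_restrict
    {q : ∀ j, (∀ k : G.Iq j, S k) → (∀ k : G.Iq j, A k) → ℝ}
    (hq : ∀ j, Measurable (fun x : (∀ k : G.Iq j, S k) × (∀ k : G.Iq j, A k) => q j x.1 x.2))
    (i : V) : Measurable (fun x : (∀ j, S j) × (∀ j, A j) =>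
      G.truncCritic q i ((G.Iqhat i).restrict x.1) ((G.Iqhat i).restrict x.2)) := by
  have h : Measurable (fun x : (∀ j, S j) × (∀ j, A j) =>
      ((G.Iqhat i).restrict x.1, (G.Iqhat i).restrict x.2)) := by fun_prop
  have h2 := (measurable_truncCritic hq i).comp h
  exact h2

theorem measurable_truncCritic_restrict_right
    {q : ∀ j, (∀ k : G.Iq j, S k) → (∀ k : G.Iq j, A k) → ℝ}
    (hq : ∀ j, Measurable (fun x : (∀ k : G.Iq j, S k) × (∀ k : G.Iq j, A k) => q j x.1 x.2))
    (i : V) (s : ∀ j, S j) : Measurable (fun a : ∀ j, A j =>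
      G.truncCritic q i ((G.Iqhat i).restrict s) ((G.Iqhat i).restrict a)) := by
  have h2 := (measurable_truncCritic_restrict hq i).comp (measurable_prodMk_left (x := s))
  exact h2

theorem measurable_Q_right
    (hB : ∀ j s, ∀ᵐ a ∂(G.globalPolicy κ s), |G.reward j (s, a)| ≤ B) (j : V) (s : ∀ j, S j) :
    Measurable (fun a => G.Q κ j s a) := by
  have h2 := (measurable_Q hB j).comp (measurable_prodMk_left (x := s))
  exact h2

variable (G) in
theorem measurable_obsLoc_me (i : V) :
    Measurable (fun x : (∀ k : G.Iqhat i, S k) × (∀ k : G.Iqhat i, A k) =>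
      (G.obsLoc (G.me i) x.1, x.2 (G.me i))) :=
  ((Finset.measurable_restrict₂ (G.Iobs_subset_Iqhat (G.me i))).comp measurable_fst).prodMk
    ((measurable_pi_apply (G.me i)).comp measurable_snd)

end TruncCritic

/-! ### Stochastic policies -/

section Stoch

variable {V : Type*} [Fintype V] [DecidableEq V] {S A : V → Type*}
  [∀ j, MeasurableSpace (S j)] [∀ j, MeasurableSpace (A j)] {d : V → ℕ} {G : Game V S A}
  {ν : ∀ j, Measure (A j)} [∀ j, SigmaFinite (ν j)]
  (π : ∀ j, StochPolicy (EuclideanSpace ℝ (Fin (d j))) (G.Obs j) (A j) (ν j))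
  (θ : ∀ j, EuclideanSpace ℝ (Fin (d j))) (i : V)

theorem globalPolicy_update_apply (ϑ : EuclideanSpace ℝ (Fin (d i))) (s : ∀ j, S j) :
    G.globalPolicy (fun j => (π j).kernel (Function.update θ i ϑ j)) s =
      Measure.pi (Function.update (fun j => (π j).kernel (θ j) ((G.Iobs j).restrict s)) i
        ((π i).kernel ϑ ((G.Iobs i).restrict s))) := by
  change Measure.pi (fun j => (π j).kernel (Function.update θ i ϑ j) ((G.Iobs j).restrict s)) = _
  congr 1
  funext j
  rcases eq_or_ne j i with rfl | h
  · simp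
  · simp [h]

/-- The average of a function of the actions over the actions of all agents but `i`. -/
def avgOthers (s : ∀ j, S j) (f : (∀ j, A j) → ℝ) (b : A i) : ℝ :=
  ∫ a, f (Function.update a i b) ∂(G.globalPolicy (fun j => (π j).kernel (θ j)) s)

variable {π θ i}

theorem measurable_avgOthers (s : ∀ j, S j) {f : (∀ j, A j) → ℝ} (hf : Measurable f) :
    Measurable (avgOthers π θ i s f) :=
  (StronglyMeasurable.integral_prod_left
    (f := fun (a : ∀ j, A j) (b : A i) => f (Function.update a i b))
    (hf.comp (measurable_update_prod i)).stronglyMeasurable).measurable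

theorem abs_avgOthers_le (s : ∀ j, S j) {f : (∀ j, A j) → ℝ} {M : ℝ} (hM : ∀ a, |f a| ≤ M)
    (b : A i) : |avgOthers π θ i s f b| ≤ M :=
  abs_integral_le_of_ae (.of_forall fun _ => hM _)

/-- Only factor `i` of the product policy varies with `ϑ`, so the one-agent estimates apply to `f`
averaged over the other agents. -/
theorem integral_globalPolicy_update (s : ∀ j, S j) {f : (∀ j, A j) → ℝ} (hf : Measurable f)
    {M : ℝ} (hM : ∀ a, |f a| ≤ M) (ϑ : EuclideanSpace ℝ (Fin (d i))) :
    ∫ a, f a ∂(G.globalPolicy (fun j => (π j).kernel (Function.update θ i ϑ j)) s) =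
      ∫ b, avgOthers π θ i s f b ∂((π i).kernel ϑ ((G.Iobs i).restrict s)) := by
  have hi : Integrable f
      (G.globalPolicy (fun j => (π j).kernel (Function.update θ i ϑ j)) s) :=
    Integrable.of_bound hf.aestronglyMeasurable M (.of_forall hM)
  rw [globalPolicy_update_apply] at hi ⊢
  exact integral_pi_update _ i _ hi

theorem measurePreserving_eval_globalPolicy (s : ∀ j, S j) :
    MeasurePreserving (Function.eval i) (G.globalPolicy (fun j => (π j).kernel (θ j)) s)
      ((π i).kernel (θ i) ((G.Iobs i).restrict s)) :=
  measurePreserving_eval (fun j => (π j).kernel (θ j) ((G.Iobs j).restrict s)) i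

theorem integrable_smul_score (hp : (π i).RegularAt (θ i)) (s : ∀ j, S j)
    {f : (∀ j, A j) → ℝ} (hf : Measurable f) {M : ℝ} (hM : ∀ a, |f a| ≤ M) :
    Integrable (fun a => f a • (π i).score (θ i) ((G.Iobs i).restrict s) (a i))
      (G.globalPolicy (fun j => (π j).kernel (θ j)) s) := by
  obtain ⟨_, _, _, _, hsc, _⟩ := hp.exists_integral_bound
  have := (measurePreserving_eval_globalPolicy s).integrable_comp_of_integrable
    (hsc ((G.Iobs i).restrict s)).1
  exact this.bdd_smul M hf.aestronglyMeasurable (.of_forall hM)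

theorem integral_smul_score (hp : (π i).RegularAt (θ i)) (s : ∀ j, S j)
    {f : (∀ j, A j) → ℝ} (hf : Measurable f) {M : ℝ} (hM : ∀ a, |f a| ≤ M) :
    ∫ a, f a • (π i).score (θ i) ((G.Iobs i).restrict s) (a i)
        ∂(G.globalPolicy (fun j => (π j).kernel (θ j)) s) =
      ∫ b, avgOthers π θ i s f b • (π i).score (θ i) ((G.Iobs i).restrict s) b
        ∂((π i).kernel (θ i) ((G.Iobs i).restrict s)) := by
  refine (integral_pi_eq (fun j => (π j).kernel (θ j) ((G.Iobs j).restrict s)) i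
    (integrable_smul_score hp s hf hM)).trans (integral_congr_ae (.of_forall fun b => ?_))
  simp only [Function.update_self]
  rw [integral_smul_const]
  rfl

/-- The constant is independent of the state because the majorants in `RegularAt` have integrals
bounded uniformly in the observation. Integrability over states and actions jointly depends on this.
-/
theorem integral_norm_smul_score_le (hp : (π i).RegularAt (θ i)) :
    ∃ C : ℝ, ∀ (s : ∀ j, S j) (f : (∀ j, A j) → ℝ), Measurable f → ∀ M, (∀ a, |f a| ≤ M) →
      ∫ a, ‖f a • (π i).score (θ i) ((G.Iobs i).restrict s) (a i)‖
        ∂(G.globalPolicy (fun j => (π j).kernel (θ j)) s) ≤ M * C := by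
  obtain ⟨_, _, C, _, hsc, _⟩ := hp.exists_integral_bound
  refine ⟨C, fun s f hf M hM => ?_⟩
  have hmp := measurePreserving_eval_globalPolicy (π := π) (θ := θ) (i := i) s
  obtain ⟨hi, hC⟩ := hsc ((G.Iobs i).restrict s)
  have hi' : Integrable (fun a => M * ‖(π i).score (θ i) ((G.Iobs i).restrict s) (a i)‖)
      (G.globalPolicy (fun j => (π j).kernel (θ j)) s) := (hmp.integrable_comp_of_integrable hi.norm).const_mul M
  refine (integral_mono (integrable_smul_score hp s hf hM).norm hi' fun a => ?_).trans ?_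
  · simp only
    rw [norm_smul]
    exact mul_le_mul_of_nonneg_right (hM a) (norm_nonneg _)
  · rw [integral_const_mul]
    have h2 : ∫ a, ‖(π i).score (θ i) ((G.Iobs i).restrict s) (a i)‖
        ∂(G.globalPolicy (fun j => (π j).kernel (θ j)) s) =
        ∫ b, ‖(π i).score (θ i) ((G.Iobs i).restrict s) b‖
          ∂((π i).kernel (θ i) ((G.Iobs i).restrict s)) := by
      have hn := hi.norm.aestronglyMeasurable
      rw [← hmp.map_eq] at hn ⊢
      exact (integral_map hmp.measurable.aemeasurable hn).symm
    rw [h2]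
    have a : ∀ j, A j := Classical.choice
      (nonempty_of_isProbabilityMeasure (G.globalPolicy (fun j => (π j).kernel (θ j)) s))
    exact mul_le_mul_of_nonneg_left hC ((abs_nonneg _).trans (hM a))

/-- The policy gradient theorem for stochastic policies, on global states and actions. -/
theorem hasGradientAt_expectedReturn_stoch (D : Measure (∀ j, S j)) [IsProbabilityMeasure D]
    {B : ℝ} (hB : ∀ j x, |G.r j x| ≤ B) (hp : (π i).RegularAt (θ i))
    {q : ∀ j, (∀ k : G.Iq j, S k) → (∀ k : G.Iq j, A k) → ℝ}
    (hq : G.IsLocalCritic (fun j => (π j).kernel (θ j)) q)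
    (hqm : ∀ j, Measurable
      (fun x : (∀ k : G.Iq j, S k) × (∀ k : G.Iq j, A k) => q j x.1 x.2))
    {M : ℝ} (hM : ∀ s a, |G.truncCritic q i s a| ≤ M) :
    HasGradientAt
      (fun ϑ => G.expectedReturn (fun j => (π j).kernel (Function.update θ i ϑ j)) D)
      ((1 - G.γ)⁻¹ • ∫ s, ∫ a, G.truncCritic q i ((G.Iqhat i).restrict s)
          ((G.Iqhat i).restrict a) • (π i).score (θ i) ((G.Iobs i).restrict s) (a i)
        ∂(G.globalPolicy (fun j => (π j).kernel (θ j)) s)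
        ∂(G.visitation (fun j => (π j).kernel (θ j)) D)) (θ i) := by
  obtain ⟨ε, hε, C, hC, -, hlip⟩ := hp.exists_integral_bound
  have hself : Function.update θ i (θ i) = θ := Function.update_eq_self i θ
  have hBr : ∀ j x, |G.reward j x| ≤ B := fun j x => hB j _
  have hR : ∀ x, |G.totalReward x| ≤ Fintype.card V * B := fun x => by
    refine (Finset.abs_sum_le_sum_abs _ _).trans ?_
    simpa using Finset.sum_le_sum fun j (_ : j ∈ Finset.univ) => hBr j x
  have hQ := measurable_truncCritic hqm i
  have hQs : Measurable (fun x : (∀ j, S j) × (∀ j, A j) =>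
      G.truncCritic q i ((G.Iqhat i).restrict x.1) ((G.Iqhat i).restrict x.2)) :=
    measurable_truncCritic_restrict hqm i
  have hgm : Measurable (fun x : (∀ j, S j) × (∀ j, A j) =>
      G.truncCritic q i ((G.Iqhat i).restrict x.1) ((G.Iqhat i).restrict x.2) •
        (π i).score (θ i) ((G.Iobs i).restrict x.1) (x.2 i)) :=
    hQs.smul (((π i).measurable_score hp.differentiableAt).comp
      (by fun_prop : Measurable (fun x : (∀ j, S j) × (∀ j, A j) =>
        ((G.Iobs i).restrict x.1, x.2 i))))
  -- The first entry serves the total reward, bounded by `Fintype.card V * B`; the second serves the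
  -- transitions, where the bound on the test function is a separate factor.
  have key := hasGradientAt_expectedReturn (B := B) (L := max (C * (Fintype.card V * B)) C)
    (fun ϑ j => (π j).kernel (Function.update θ i ϑ j)) (θ i) D hε
    (fun ϑ _ j s => .of_forall fun a => hBr j (s, a)) ?_ ?_
    (g := fun s => ∫ a, G.truncCritic q i ((G.Iqhat i).restrict s)
        ((G.Iqhat i).restrict a) • (π i).score (θ i) ((G.Iobs i).restrict s) (a i)
      ∂(G.globalPolicy (fun j => (π j).kernel (θ j)) s)) ?_ ?_
  · simp only [hself] at key
    exact key.2
  · intro ϑ hϑ s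
    have hm : Measurable (fun a => G.totalReward (s, a)) :=
      G.measurable_totalReward.comp measurable_prodMk_left
    rw [integral_globalPolicy_update s hm (fun a => hR (s, a)),
      integral_globalPolicy_update s hm (fun a => hR (s, a))]
    refine ((hlip _ _ (measurable_avgOthers s hm)
      (abs_avgOthers_le s (fun a => hR (s, a))) _).2 ϑ hϑ).trans ?_
    gcongr
    exact le_max_left _ _
  · intro w hw K hK ϑ hϑ s
    have hm : Measurable (fun a => ∫ s', w s' ∂(G.transition (s, a))) :=
      (measurable_integral_transition hw).comp measurable_prodMk_left
    have hb : ∀ a, |∫ s', w s' ∂(G.transition (s, a))| ≤ K := fun a =>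
      abs_integral_le_of_ae (.of_forall hK)
    rw [integral_globalPolicy_update s hm hb, integral_globalPolicy_update s hm hb]
    refine ((hlip _ _ (measurable_avgOthers s hm) (abs_avgOthers_le s hb) _).2 ϑ hϑ).trans ?_
    have : 0 ≤ K := (abs_nonneg _).trans (hK s)
    gcongr
    exact le_max_right _ _
  · exact ((hgm.stronglyMeasurable.integral_kernel_prod_right'
      (κ := G.globalPolicy (fun j => (π j).kernel (θ j))))).aestronglyMeasurable
  · intro s
    simp only [hself]
    have hBa : ∀ j s, ∀ᵐ a ∂(G.globalPolicy (fun j => (π j).kernel (θ j)) s),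
        |G.reward j (s, a)| ≤ B := fun j s => .of_forall fun a => hBr j (s, a)
    have hQall : ∀ x : (∀ j, S j) × (∀ j, A j), ∀ j,
        |G.Q (fun j => (π j).kernel (θ j)) j x.1 x.2| ≤ (1 - G.γ)⁻¹ * B := by
      intro x j
      rw [Q_eq_discSum hBa]
      exact abs_discSum_le (G.measurable_reward j) G.γ_nonneg G.γ_lt_one
        (ae_ctrlStep (G.measurable_reward j) (hBa j)) (hBr j x)
    have hbs : ∀ (I : Finset V) (a : ∀ j, A j),
        |∑ j ∈ I, G.Q (fun j => (π j).kernel (θ j)) j s a| ≤ I.card * ((1 - G.γ)⁻¹ * B) := by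
      intro I a
      refine (Finset.abs_sum_le_sum_abs _ _).trans ?_
      simpa using Finset.sum_le_sum fun j (_ : j ∈ I) => hQall (s, a) j
    have hms : ∀ I : Finset V,
        Measurable (fun a => ∑ j ∈ I, G.Q (fun j => (π j).kernel (θ j)) j s a) := fun I =>
      Finset.measurable_sum _ fun j _ => measurable_Q_right hBa j s
    have hmQ : Measurable (fun a => G.truncCritic q i ((G.Iqhat i).restrict s)
        ((G.Iqhat i).restrict a)) := measurable_truncCritic_restrict_right hqm i s
    have hbQ : ∀ a, |G.truncCritic q i ((G.Iqhat i).restrict s) ((G.Iqhat i).restrict a)| ≤ M :=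
      fun a => hM _ _
    -- Only the truncated critic is differentiated. The critics outside `Igd i` ignore the action of
    -- `i` and add a constant in `ϑ`.
    have h1 := ((hlip _ _ (measurable_avgOthers (π := π) (θ := θ) (i := i) s hmQ)
      (abs_avgOthers_le s hbQ) ((G.Iobs i).restrict s)).1).add_const_right
      (∫ a, ∑ j ∈ (G.Igd i)ᶜ, G.Q (fun j => (π j).kernel (θ j)) j s a
        ∂(G.globalPolicy (fun j => (π j).kernel (θ j)) s))
    rw [← integral_smul_score hp s hmQ hbQ] at h1
    convert h1 using 2 with ϑ
    rw [integral_globalPolicy_update s (hms Finset.univ) (hbs Finset.univ)]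
    have h2 : ∀ b, avgOthers π θ i s
        (fun a => ∑ j, G.Q (fun j => (π j).kernel (θ j)) j s a) b =
        avgOthers π θ i s (fun a => G.truncCritic q i ((G.Iqhat i).restrict s)
          ((G.Iqhat i).restrict a)) b +
          ∫ a, ∑ j ∈ (G.Igd i)ᶜ, G.Q (fun j => (π j).kernel (θ j)) j s a
            ∂(G.globalPolicy (fun j => (π j).kernel (θ j)) s) := by
      intro b
      unfold avgOthers
      rw [← integral_add]
      · exact integral_congr_ae (.of_forall fun a => sum_Q_update hBa hq i s a b)
      · refine Integrable.of_bound (C := M) (Measurable.aestronglyMeasurable ?_)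
          (.of_forall fun a => hbQ _)
        exact hmQ.comp ((measurable_update_prod i).comp measurable_prodMk_right)
      · exact Integrable.of_bound (hms _).aestronglyMeasurable _ (.of_forall (hbs _))
    simp_rw [h2]
    rw [integral_add, integral_const, probReal_univ, one_smul]
    · exact Integrable.of_bound (measurable_avgOthers s hmQ).aestronglyMeasurable M
        (.of_forall (abs_avgOthers_le s hbQ))
    · exact integrable_const _

/-- The gradient of the logarithm is the score where the density is nonzero, and the policy almost
surely plays such actions. -/
theorem stochIntegrand_ae_eq (D : Measure (∀ j, S j)) [IsProbabilityMeasure D]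
    (hp : (π i).RegularAt (θ i)) (q : ∀ j, (∀ k : G.Iq j, S k) → (∀ k : G.Iq j, A k) → ℝ) :
    G.stochIntegrand π θ q i =ᵐ[G.visitationLoc (fun j => (π j).kernel (θ j)) D i ⊗ₘ
        G.policyLoc (fun j => (π j).kernel (θ j)) i]
      fun x => G.truncCritic q i x.1 x.2 •
        (π i).score (θ i) (G.obsLoc (G.me i) x.1) (x.2 (G.me i)) := by
  have hm : Measurable (fun x : (∀ k : G.Iqhat i, S k) × (∀ k : G.Iqhat i, A k) =>
      (π i).dens (θ i) (G.obsLoc (G.me i) x.1) (x.2 (G.me i))) :=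
    ((π i).measurable_dens (θ i)).comp (G.measurable_obsLoc_me i)
  have hae : ∀ᵐ x ∂(G.visitationLoc (fun j => (π j).kernel (θ j)) D i ⊗ₘ
      G.policyLoc (fun j => (π j).kernel (θ j)) i),
      (π i).dens (θ i) (G.obsLoc (G.me i) x.1) (x.2 (G.me i)) ≠ 0 := by
    refine Measure.ae_compProd_of_ae_ae
      (measurableSet_eq_fun hm measurable_const).compl (.of_forall fun s => ?_)
    exact (measurePreserving_eval (fun j : G.Iqhat i => (π j).kernel (θ j) (G.obsLoc j s))
      (G.me i)).quasiMeasurePreserving.ae ((π i).ae_dens_ne_zero (θ i) (G.obsLoc (G.me i) s))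
  filter_upwards [hae] with x hx
  rw [stochIntegrand, (π i).gradient_log_dens hp.differentiableAt hx]

theorem exists_localCritic_of_bounded (D : Measure (∀ j, S j)) [IsProbabilityMeasure D] (i : V)
    {B : ℝ} (hB : ∀ j x, |G.r j x| ≤ B) :
    ∃ q, G.IsLocalCritic (fun j => (π j).kernel (θ j)) q ∧
      (∀ j, Measurable
        (fun x : (∀ k : G.Iq j, S k) × (∀ k : G.Iq j, A k) => q j x.1 x.2)) ∧
      ∃ M, ∀ s a, |G.truncCritic q i s a| ≤ M := by
  have hBr : ∀ j x, |G.reward j x| ≤ B := fun j x => hB j _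
  have hBa : ∀ j s, ∀ᵐ a ∂(G.globalPolicy (fun j => (π j).kernel (θ j)) s),
      |G.reward j (s, a)| ≤ B := fun j s => .of_forall fun a => hBr j (s, a)
  -- The default values for extending partial tuples exist because `D` and the global policy have
  -- mass `1`.
  obtain ⟨zs⟩ : Nonempty (∀ j, S j) := nonempty_of_isProbabilityMeasure D
  obtain ⟨za⟩ : Nonempty (∀ j, A j) := nonempty_of_isProbabilityMeasure
    (G.globalPolicy (fun j => (π j).kernel (θ j)) zs)
  refine ⟨G.localCritic (fun j => (π j).kernel (θ j)) zs za,
    isLocalCritic_localCritic hBa zs za, measurable_localCritic hBa zs za,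
    ∑ j : G.Igd i, (1 - G.γ)⁻¹ * B, fun s a => ?_⟩
  refine (Finset.abs_sum_le_sum_abs _ _).trans (Finset.sum_le_sum fun j _ => ?_)
  unfold localCritic
  rw [Q_eq_discSum hBa]
  exact abs_discSum_le (G.measurable_reward j) G.γ_nonneg G.γ_lt_one
    (ae_ctrlStep (G.measurable_reward j) (hBa j)) (hBr _ _)

theorem stoch_policy_gradient (D : Measure (∀ j, S j)) [IsProbabilityMeasure D]
    (hr : ∃ B : ℝ, ∀ j x, |G.r j x| ≤ B) (hp : (π i).RegularAt (θ i)) :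
    ∃ q, G.IsLocalCritic (fun j => (π j).kernel (θ j)) q ∧
      Integrable (G.stochIntegrand π θ q i)
        (G.visitationLoc (fun j => (π j).kernel (θ j)) D i ⊗ₘ
          G.policyLoc (fun j => (π j).kernel (θ j)) i) ∧
      HasGradientAt
        (fun ϑ => G.expectedReturn (fun j => (π j).kernel (Function.update θ i ϑ j)) D)
        ((1 - G.γ)⁻¹ • ∫ x, G.stochIntegrand π θ q i x
          ∂(G.visitationLoc (fun j => (π j).kernel (θ j)) D i ⊗ₘ
          G.policyLoc (fun j => (π j).kernel (θ j)) i)) (θ i) := by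
  obtain ⟨B, hB⟩ := hr
  obtain ⟨q, hq, hqm, M, hM⟩ := exists_localCritic_of_bounded (π := π) (θ := θ) D i hB
  have hQ := measurable_truncCritic hqm i
  -- A measurable representative of the integrand, with the score in place of the gradient of the
  -- logarithm.
  set Φ : (∀ k : G.Iqhat i, S k) × (∀ k : G.Iqhat i, A k) → EuclideanSpace ℝ (Fin (d i)) :=
    fun x => G.truncCritic q i x.1 x.2 •
      (π i).score (θ i) (G.obsLoc (G.me i) x.1) (x.2 (G.me i)) with hΦ
  have hΦm : Measurable Φ := hQ.smul (((π i).measurable_score hp.differentiableAt).comp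
    (G.measurable_obsLoc_me i))
  have hae := stochIntegrand_ae_eq D hp q
  have hρ : Measurable (Prod.map (G.Iqhat i).restrict (G.Iqhat i).restrict :
      (∀ j, S j) × (∀ j, A j) → _) := by fun_prop
  have hΦi : Integrable (Φ ∘ Prod.map (G.Iqhat i).restrict (G.Iqhat i).restrict)
      (G.visitation (fun j => (π j).kernel (θ j)) D ⊗ₘ
        G.globalPolicy (fun j => (π j).kernel (θ j))) := by
    rw [Measure.integrable_compProd_iff (hΦm.comp hρ).aestronglyMeasurable]
    have hms : ∀ s, Measurable (fun a => G.truncCritic q i ((G.Iqhat i).restrict s)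
        ((G.Iqhat i).restrict a)) := fun s => measurable_truncCritic_restrict_right hqm i s
    refine ⟨.of_forall fun s => integrable_smul_score hp s (hms s) (fun a => hM _ _), ?_⟩
    obtain ⟨C, hC⟩ := integral_norm_smul_score_le (G := G) hp
    refine Integrable.of_bound (C := M * C) ?_ (.of_forall fun s => ?_)
    · exact ((hΦm.comp hρ).norm.stronglyMeasurable.integral_kernel_prod_right'
        (κ := G.globalPolicy (fun j => (π j).kernel (θ j)))).aestronglyMeasurable
    · rw [Real.norm_of_nonneg (integral_nonneg fun _ => norm_nonneg _)]
      exact hC s _ (hms s) M fun a => hM _ _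
  refine ⟨q, hq, ?_, ?_⟩
  · refine Integrable.congr ?_ hae.symm
    rw [visitationLoc_compProd]
    exact (integrable_map_measure hΦm.aestronglyMeasurable hρ.aemeasurable).2 hΦi
  · rw [integral_congr_ae hae, visitationLoc_compProd,
      integral_map hρ.aemeasurable hΦm.aestronglyMeasurable]
    have e := Measure.integral_compProd hΦi
    simp only [Function.comp_apply] at e
    rw [e]
    exact hasGradientAt_expectedReturn_stoch D hB hp hq hqm hM

end Stoch

end Game

end MARL

namespace MARL

/-! ### Calculus of jointly continuous families of differentiable maps -/

namespace ContC1

variable {X X' : Type*} [TopologicalSpace X] [TopologicalSpace X']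
  {E E' F : Type*} [NormedAddCommGroup E] [NormedSpace ℝ E]
  [NormedAddCommGroup E'] [NormedSpace ℝ E'] [NormedAddCommGroup F] [NormedSpace ℝ F]

theorem of_hasFDerivAt {f : X → E → F} {f' : X → E → E →L[ℝ] F}
    (hf : Continuous (Function.uncurry f)) (hd : ∀ x e, HasFDerivAt (f x) (f' x e) e)
    (hf' : Continuous (Function.uncurry f')) : ContC1 f := by
  refine ⟨hf, fun x e => (hd x e).differentiableAt, ?_⟩
  have : (fun y : X × E => fderiv ℝ (f y.1) y.2) = Function.uncurry f' := by
    funext y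
    exact (hd y.1 y.2).fderiv
  rwa [this]

theorem hasFDerivAt {f : X → E → F} (hf : ContC1 f) (x : X) (e : E) :
    HasFDerivAt (f x) (fderiv ℝ (f x) e) e := (hf.2.1 x e).hasFDerivAt

theorem comp {f : X → E → F} (hf : ContC1 f) {φ : X' → X} (hφ : Continuous φ)
    {g : X' → E' → E} (hg : ContC1 g) : ContC1 (fun x e => f (φ x) (g x e)) := by
  have hc : Continuous (fun y : X' × E' => (φ y.1, g y.1 y.2)) :=
    (hφ.comp continuous_fst).prodMk hg.1
  refine of_hasFDerivAt (f' := fun x e =>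
    (fderiv ℝ (f (φ x)) (g x e)).comp (fderiv ℝ (g x) e)) (hf.1.comp hc)
    (fun x e => (hf.hasFDerivAt _ _).comp e (hg.hasFDerivAt x e)) ?_
  exact (hf.2.2.comp hc).clm_comp hg.2.2

theorem of_clm (ℓ : E →L[ℝ] F) : ContC1 (fun (_ : X) e => ℓ e) :=
  of_hasFDerivAt (f' := fun _ _ => ℓ) (ℓ.continuous.comp continuous_snd)
    (fun _ _ => ℓ.hasFDerivAt) continuous_const

theorem of_continuous {c : X → F} (hc : Continuous c) : ContC1 (fun x (_ : E) => c x) :=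
  of_hasFDerivAt (f' := fun _ _ => 0) (hc.comp continuous_fst)
    (fun _ _ => hasFDerivAt_const _ _) continuous_const

theorem comp_clm {f : X → E → F} (hf : ContC1 f) {φ : X' → X} (hφ : Continuous φ)
    (ℓ : E' →L[ℝ] E) : ContC1 (fun x e => f (φ x) (ℓ e)) :=
  hf.comp hφ (of_clm ℓ)

theorem add {f g : X → E → F} (hf : ContC1 f) (hg : ContC1 g) :
    ContC1 (fun x e => f x e + g x e) :=
  of_hasFDerivAt (hf.1.add hg.1) (fun x e => (hf.hasFDerivAt x e).add (hg.hasFDerivAt x e))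
    (hf.2.2.add hg.2.2)

theorem const_mul {f : X → E → ℝ} (hf : ContC1 f) (c : ℝ) : ContC1 (fun x e => c * f x e) :=
  of_hasFDerivAt (hf.1.const_mul c) (fun x e => (hf.hasFDerivAt x e).const_mul c)
    (hf.2.2.const_smul c)

theorem mul {f g : X → E → ℝ} (hf : ContC1 f) (hg : ContC1 g) :
    ContC1 (fun x e => f x e * g x e) :=
  of_hasFDerivAt (hf.1.mul hg.1) (fun x e => (hf.hasFDerivAt x e).mul (hg.hasFDerivAt x e))
    ((hf.1.smul hg.2.2).add (hg.1.smul hf.2.2))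

theorem finset_sum {ι : Type*} (s : Finset ι) {f : ι → X → E → ℝ} (hf : ∀ i, ContC1 (f i)) :
    ContC1 (fun x e => ∑ i ∈ s, f i x e) := by
  classical
  induction s using Finset.induction_on with
  | empty => simpa using of_continuous continuous_const
  | insert i s hi ih => simpa only [Finset.sum_insert hi] using (hf i).add ih

theorem finset_prod {ι : Type*} (s : Finset ι) {f : ι → X → E → ℝ} (hf : ∀ i, ContC1 (f i)) :
    ContC1 (fun x e => ∏ i ∈ s, f i x e) := by
  classical
  induction s using Finset.induction_on with
  | empty => simpa using of_continuous continuous_const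
  | insert i s hi ih => simpa only [Finset.prod_insert hi] using (hf i).mul ih

theorem update {ι : Type*} [Fintype ι] [DecidableEq ι] {Y : ι → Type*}
    [∀ i, NormedAddCommGroup (Y i)] [∀ i, NormedSpace ℝ (Y i)] {c : X → ∀ i, Y i}
    (hc : Continuous c) (i : ι) : ContC1 (fun x (b : Y i) => Function.update (c x) i b) :=
  of_hasFDerivAt
    (f' := fun _ _ => ContinuousLinearMap.pi (Pi.single i (ContinuousLinearMap.id ℝ (Y i))))
    ((hc.comp continuous_fst).update i continuous_snd)
    (fun x b => hasFDerivAt_update (c x) b)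
    continuous_const

/-- On a compact space, a `ContC1` family is Lipschitz near a point, uniformly in the family. -/
theorem exists_lipschitz [CompactSpace X] [ProperSpace E] {f : X → E → F} (hf : ContC1 f)
    (e₀ : E) : ∃ L, 0 ≤ L ∧ ∀ x, ∀ e ∈ Metric.ball e₀ 1, ‖f x e - f x e₀‖ ≤ L * ‖e - e₀‖ := by
  -- The derivative is bounded on the compact product with a closed ball, and the ball is convex;
  -- the radius `1` is arbitrary.
  obtain ⟨L, hL⟩ := (isCompact_univ.prod (isCompact_closedBall e₀ 1)).exists_bound_of_continuousOn
    hf.2.2.continuousOn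
  refine ⟨max L 0, le_max_right _ _, fun x e he => ?_⟩
  refine (convex_closedBall e₀ 1).norm_image_sub_le_of_norm_fderiv_le (𝕜 := ℝ)
    (fun e' _ => hf.2.1 x e') (fun e' he' => ?_) (Metric.mem_closedBall_self zero_le_one)
    (Metric.ball_subset_closedBall he)
  exact (hL (x, e') ⟨Set.mem_univ _, he'⟩).trans (le_max_left _ _)

end ContC1

/-! ### Integrals depending on a parameter over compact spaces -/

section ParametricIntegral

variable {X Y : Type*} [TopologicalSpace X] [FirstCountableTopology X] [CompactSpace X]
  [TopologicalSpace Y] [CompactSpace Y] [SecondCountableTopology Y]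
  [MeasurableSpace Y] [OpensMeasurableSpace Y]
  {E F : Type*} [NormedAddCommGroup E] [NormedSpace ℝ E] [ProperSpace E]
  [NormedAddCommGroup F] [NormedSpace ℝ F]
  {ρ : Measure Y} [IsFiniteMeasure ρ] {v : Y → ℝ} {M : ℝ}

theorem aestronglyMeasurable_smul_continuous (hv : Measurable v) {f : Y → F}
    (hf : Continuous f) : AEStronglyMeasurable (fun y => v y • f y) ρ :=
  hv.aestronglyMeasurable.smul hf.aestronglyMeasurable

theorem exists_bound_smul (hM : ∀ y, |v y| ≤ M) {f : X × Y → E → F}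
    (hf : Continuous (Function.uncurry f)) (e₀ : E) :
    ∃ C, ∀ x y, ∀ e ∈ Metric.closedBall e₀ 1, ‖v y • f (x, y) e‖ ≤ C := by
  obtain ⟨C, hC⟩ := (isCompact_univ.prod (isCompact_closedBall e₀ 1)).exists_bound_of_continuousOn
    hf.continuousOn
  refine ⟨M * C, fun x y e he => ?_⟩
  rw [norm_smul]
  exact mul_le_mul (hM y) (hC ((x, y), e) ⟨Set.mem_univ _, he⟩) (norm_nonneg _)
    ((abs_nonneg _).trans (hM y))

theorem continuous_integral_smul (hv : Measurable v) (hM : ∀ y, |v y| ≤ M)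
    {f : X × Y → E → F} (hf : Continuous (Function.uncurry f)) :
    Continuous (fun z : X × E => ∫ y, v y • f (z.1, y) z.2 ∂ρ) := by
  rw [continuous_iff_continuousAt]
  rintro ⟨x₀, e₀⟩
  obtain ⟨C, hC⟩ := exists_bound_smul hM hf e₀
  have hc : ∀ z : X × E, Continuous (fun y => f (z.1, y) z.2) := fun z =>
    hf.comp (by fun_prop : Continuous (fun y => ((z.1, y), z.2)))
  refine continuousAt_of_dominated (bound := fun _ => C)
    (.of_forall fun z => aestronglyMeasurable_smul_continuous hv (hc z)) ?_
    (integrable_const _) (.of_forall fun y => ?_)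
  · have : ∀ᶠ z : X × E in nhds (x₀, e₀), z.2 ∈ Metric.closedBall e₀ 1 :=
      continuous_snd.continuousAt.eventually_mem (Metric.closedBall_mem_nhds e₀ one_pos)
    filter_upwards [this] with z hz
    exact .of_forall fun y => hC z.1 y z.2 hz
  · have h2 : Continuous (fun z : X × E => f (z.1, y) z.2) :=
      hf.comp (by fun_prop : Continuous (fun z : X × E => ((z.1, y), z.2)))
    exact (h2.const_smul (v y)).continuousAt

/-- All smoothness comes from `f`: the weight `v` will be a value function, used only through
measurability and a bound. Compactness of `X`, `Y` and closed balls gives constant majorants. -/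
theorem ContC1.integral_mul (hv : Measurable v) (hM : ∀ y, |v y| ≤ M)
    {f : X × Y → E → ℝ} (hf : ContC1 f) :
    ContC1 (fun x e => ∫ y, v y * f (x, y) e ∂ρ) := by
  refine ContC1.of_hasFDerivAt
    (f' := fun x e => ∫ y, v y • fderiv ℝ (f (x, y)) e ∂ρ)
    (continuous_integral_smul hv hM hf.1) (fun x e => ?_)
    (continuous_integral_smul (f := fun z e => fderiv ℝ (f z) e) hv hM hf.2.2)
  obtain ⟨C, hC⟩ := exists_bound_smul (f := fun z e => fderiv ℝ (f z) e) hM hf.2.2 e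
  obtain ⟨C', hC'⟩ := exists_bound_smul hM hf.1 e
  have hm : ∀ e', AEStronglyMeasurable (fun y => v y * f (x, y) e') ρ := fun e' =>
    aestronglyMeasurable_smul_continuous hv
      (hf.1.comp (by fun_prop : Continuous (fun y => ((x, y), e'))))
  refine hasFDerivAt_integral_of_dominated_of_fderiv_le (𝕜 := ℝ) (bound := fun _ => C)
    (F' := fun e y => v y • fderiv ℝ (f (x, y)) e)
    (Metric.closedBall_mem_nhds e one_pos) (.of_forall hm) ?_ ?_
    (.of_forall fun y e' he' => hC x y e' he') (integrable_const _)
    (.of_forall fun y e' _ => (hf.hasFDerivAt (x, y) e').const_mul (v y))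
  · exact Integrable.of_bound (hm e) C'
      (.of_forall fun y => hC' x y e (Metric.mem_closedBall_self zero_le_one))
  · exact aestronglyMeasurable_smul_continuous hv
      (hf.2.2.comp (by fun_prop : Continuous (fun y => ((x, y), e))))

end ParametricIntegral

end MARL

/-! ### Transition densities and joint actions of deterministic policies -/

namespace MARL

/-- Both sides agree on rectangles, where the integral of the product density factorizes. -/
theorem pi_withDensity_ofReal {ι : Type*} [Fintype ι] {Y : ι → Type*}
    [∀ i, MeasurableSpace (Y i)] (ρ : ∀ i, Measure (Y i)) [∀ i, IsFiniteMeasure (ρ i)]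
    {f : ∀ i, Y i → ℝ} (hf0 : ∀ i y, 0 ≤ f i y) (hf : ∀ i, Integrable (f i) (ρ i)) :
    Measure.pi (fun i => (ρ i).withDensity (fun y => ENNReal.ofReal (f i y))) =
      (Measure.pi ρ).withDensity (fun y => ENNReal.ofReal (∏ i, f i (y i))) := by
  have hfin : ∀ i, IsFiniteMeasure ((ρ i).withDensity (fun y => ENNReal.ofReal (f i y))) :=
    fun i => isFiniteMeasure_withDensity_ofReal (hf i).2
  refine Measure.pi_eq fun s hs => ?_
  rw [withDensity_apply _ (MeasurableSet.univ_pi hs), Measure.restrict_pi_pi,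
    ← ofReal_integral_eq_lintegral_ofReal (Integrable.fintype_prod_dep fun i => (hf i).restrict)
      (.of_forall fun y => Finset.prod_nonneg fun i _ => hf0 i _),
    integral_fintype_prod_eq_prod,
    ENNReal.ofReal_prod_of_nonneg fun i _ => integral_nonneg (hf0 i)]
  refine Finset.prod_congr rfl fun i _ => ?_
  rw [withDensity_apply _ (hs i),
    ofReal_integral_eq_lintegral_ofReal (hf i).restrict (.of_forall (hf0 i))]

theorem pi_dirac {ι : Type*} [Fintype ι] {Y : ι → Type*} [∀ i, MeasurableSpace (Y i)]
    (a : ∀ i, Y i) : Measure.pi (fun i => Measure.dirac (a i)) = Measure.dirac a := by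
  rw [← Measure.infinitePi_eq_pi, Measure.infinitePi_dirac]

/-- Restriction to a finset of coordinates as a continuous linear map. -/
def restrictCLM {V : Type*} {Y : V → Type*} [∀ j, NormedAddCommGroup (Y j)]
    [∀ j, NormedSpace ℝ (Y j)] (I : Finset V) : (∀ j, Y j) →L[ℝ] (∀ k : I, Y k) :=
  ContinuousLinearMap.pi fun k : I => ContinuousLinearMap.proj (k : V)

/-- Restriction between finsets of coordinates as a continuous linear map. -/
def restrict₂CLM {V : Type*} {Y : V → Type*} [∀ j, NormedAddCommGroup (Y j)]
    [∀ j, NormedSpace ℝ (Y j)] {I J : Finset V} (h : I ⊆ J) :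
    (∀ k : J, Y k) →L[ℝ] (∀ k : I, Y k) :=
  ContinuousLinearMap.pi fun k : I => ContinuousLinearMap.proj (⟨k, h k.2⟩ : J)

theorem continuous_extendBy {V : Type*} [DecidableEq V] {S : V → Type*}
    [∀ j, TopologicalSpace (S j)] (I : Finset V) (z : ∀ k, S k) :
    Continuous (extendBy I z) := by
  refine continuous_pi fun k => ?_
  by_cases h : k ∈ I
  · simp only [extendBy, h, dite_true]
    fun_prop
  · simp only [extendBy, h, dite_false]
    fun_prop

/-- Extension by zero as a continuous linear map. -/
def extendCLM {V : Type*} [DecidableEq V] {Y : V → Type*} [∀ j, NormedAddCommGroup (Y j)]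
    [∀ j, NormedSpace ℝ (Y j)] (I : Finset V) : (∀ k : I, Y k) →L[ℝ] (∀ j, Y j) :=
  ContinuousLinearMap.pi fun j =>
    if h : j ∈ I then ContinuousLinearMap.proj (⟨j, h⟩ : I) else 0

theorem extendCLM_apply {V : Type*} [DecidableEq V] {Y : V → Type*}
    [∀ j, NormedAddCommGroup (Y j)] [∀ j, NormedSpace ℝ (Y j)] (I : Finset V)
    (a : ∀ k : I, Y k) : extendCLM I a = extendBy I 0 a := by
  funext j
  by_cases h : j ∈ I <;> simp [extendCLM, extendBy, h]

namespace Game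

section Det

variable {V : Type*} [Fintype V] [DecidableEq V] {S : V → Type*} [∀ j, MetricSpace (S j)]
  [∀ j, CompactSpace (S j)] [∀ j, MeasurableSpace (S j)] [∀ j, BorelSpace (S j)]
  {d m : V → ℕ} {G : Game V S (fun j => EuclideanSpace ℝ (Fin (m j)))}

/-- The density of the global transition law. -/
def globalDens (p : ∀ j, (∀ k : nbrs G.ES j, S k) →
      (∀ k : nbrs G.ES j, EuclideanSpace ℝ (Fin (m k))) → S j → ℝ)
    (x : (∀ j, S j) × (∀ j, S j)) (a : ∀ j, EuclideanSpace ℝ (Fin (m j))) : ℝ :=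
  ∏ j, p j ((nbrs G.ES j).restrict x.1) ((nbrs G.ES j).restrict a) (x.2 j)

section Transition

variable {ρ : ∀ j, Measure (S j)} [∀ j, IsFiniteMeasure (ρ j)]
  {p : ∀ j, (∀ k : nbrs G.ES j, S k) →
    (∀ k : nbrs G.ES j, EuclideanSpace ℝ (Fin (m k))) → S j → ℝ}
  (hp0 : ∀ j s a s', 0 ≤ p j s a s')
  (hP : ∀ j s a, G.P j (s, a) = (ρ j).withDensity (fun s' => ENNReal.ofReal (p j s a s')))
  (hpC : ∀ j, ContC1 (fun (x : (∀ k : nbrs G.ES j, S k) × S j)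
    (a : ∀ k : nbrs G.ES j, EuclideanSpace ℝ (Fin (m k))) => p j x.1 a x.2))

include hpC in
theorem contC1_globalDens : ContC1 (globalDens p) := by
  refine ContC1.finset_prod Finset.univ fun j => ?_
  exact (hpC j).comp_clm (φ := fun x : (∀ j, S j) × (∀ j, S j) =>
    ((nbrs G.ES j).restrict x.1, x.2 j)) (by fun_prop)
    (restrictCLM (Y := fun j => EuclideanSpace ℝ (Fin (m j))) (nbrs G.ES j))

include hp0 hP hpC in
theorem transition_eq_withDensity (s : ∀ j, S j) (a : ∀ j, EuclideanSpace ℝ (Fin (m j))) :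
    G.transition (s, a) = (Measure.pi ρ).withDensity
      (fun s' => ENNReal.ofReal (globalDens p (s, s') a)) := by
  have h1 : G.transition (s, a) = Measure.pi (fun j => G.P j
    ((nbrs G.ES j).restrict s, (nbrs G.ES j).restrict a)) := rfl
  rw [h1]
  simp_rw [hP]
  refine pi_withDensity_ofReal ρ (fun j y => hp0 j _ _ _) fun j => ?_
  have hc : Continuous (fun y => p j ((nbrs G.ES j).restrict s)
      ((nbrs G.ES j).restrict a) y) :=
    (hpC j).1.comp (by fun_prop : Continuous (fun y : S j =>
      ((((nbrs G.ES j).restrict s), y), (nbrs G.ES j).restrict a)))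
  obtain ⟨C, hC⟩ := isCompact_univ.exists_bound_of_continuousOn hc.continuousOn
  exact Integrable.of_bound hc.aestronglyMeasurable C (.of_forall fun y => hC y (Set.mem_univ y))

include hp0 hP hpC in
theorem integral_transition (s : ∀ j, S j) (a : ∀ j, EuclideanSpace ℝ (Fin (m j)))
    (w : (∀ j, S j) → ℝ) :
    ∫ s', w s' ∂(G.transition (s, a)) = ∫ s', w s' * globalDens p (s, s') a ∂(Measure.pi ρ) := by
  have hc : Continuous (fun s' => globalDens p (s, s') a) :=
    (contC1_globalDens hpC).1.comp (by fun_prop : Continuous (fun s' => ((s, s'), a)))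
  rw [transition_eq_withDensity hp0 hP hpC, integral_withDensity_eq_integral_toReal_smul
    hc.measurable.ennreal_ofReal (.of_forall fun _ => ENNReal.ofReal_lt_top)]
  refine integral_congr_ae (.of_forall fun s' => ?_)
  simp only [smul_eq_mul]
  rw [ENNReal.toReal_ofReal, mul_comm]
  exact Finset.prod_nonneg fun j _ => hp0 j _ _ _

end Transition

theorem contC1_reward (hr : ∀ j, ContC1 (fun (s : ∀ k : nbrs G.ER j, S k)
      (a : ∀ k : nbrs G.ER j, EuclideanSpace ℝ (Fin (m k))) => G.r j (s, a))) (j : V) :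
    ContC1 (fun (s : ∀ j, S j) (a : ∀ j, EuclideanSpace ℝ (Fin (m j))) => G.reward j (s, a)) :=
  (hr j).comp_clm (φ := fun s : ∀ j, S j => (nbrs G.ER j).restrict s) (by fun_prop)
    (restrictCLM (Y := fun j => EuclideanSpace ℝ (Fin (m j))) (nbrs G.ER j))

variable (π : ∀ j, DetPolicy (EuclideanSpace ℝ (Fin (d j))) (G.Obs j)
    (EuclideanSpace ℝ (Fin (m j)))) (θ : ∀ j, EuclideanSpace ℝ (Fin (d j))) (i : V)

/-- The actions of all agents in a global state. -/
def globalAct (s : ∀ j, S j) (j : V) : EuclideanSpace ℝ (Fin (m j)) :=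
  (π j).act (θ j) ((G.Iobs j).restrict s)

/-- The actions of all agents in a global state, when agent `i` uses the parameter `ϑ`. -/
def globalActUpdate (s : ∀ j, S j) (ϑ : EuclideanSpace ℝ (Fin (d i))) :
    ∀ j, EuclideanSpace ℝ (Fin (m j)) :=
  Function.update (globalAct π θ s) i ((π i).act ϑ ((G.Iobs i).restrict s))

theorem globalPolicy_det (s : ∀ j, S j) :
    G.globalPolicy (fun j => (π j).kernel (θ j)) s = Measure.dirac (globalAct π θ s) :=
  pi_dirac (globalAct π θ s)

theorem globalPolicy_det_update (s : ∀ j, S j) (ϑ : EuclideanSpace ℝ (Fin (d i))) :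
    G.globalPolicy (fun j => (π j).kernel (Function.update θ i ϑ j)) s =
      Measure.dirac (globalActUpdate π θ i s ϑ) := by
  rw [globalPolicy_det]
  congr 1
  funext j
  rcases eq_or_ne j i with rfl | h
  · simp [globalAct, globalActUpdate]
  · simp [globalAct, globalActUpdate, h]

variable {π} (hπ : ∀ j, ContC1 (fun (o : G.Obs j) (ϑ : EuclideanSpace ℝ (Fin (d j))) =>
    (π j).act ϑ o))

include hπ in
theorem continuous_act {X : Type*} [TopologicalSpace X] (j : V) {o : X → G.Obs j}
    (ho : Continuous o) : Continuous (fun x => (π j).act (θ j) (o x)) :=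
  (hπ j).1.comp (ho.prodMk continuous_const)

include hπ in
theorem contC1_globalActUpdate : ContC1 (globalActUpdate π θ i) := by
  have hc : Continuous (globalAct π θ) :=
    continuous_pi fun j => continuous_act θ hπ j (by fun_prop)
  exact (ContC1.update hc i).comp continuous_id
    ((hπ i).comp_clm (φ := fun s : ∀ j, S j => (G.Iobs i).restrict s) (by fun_prop)
      (ContinuousLinearMap.id ℝ _))

end Det

end Game

end MARL

namespace MARL

namespace Game

/-! ### Deterministic policies -/

section DetGradient

variable {V : Type*} [Fintype V] [DecidableEq V] {S : V → Type*} [∀ j, MetricSpace (S j)]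
  [∀ j, CompactSpace (S j)] [∀ j, MeasurableSpace (S j)] [∀ j, BorelSpace (S j)]
  {d m : V → ℕ} {G : Game V S (fun j => EuclideanSpace ℝ (Fin (m j)))}
  {ρ : ∀ j, Measure (S j)} [∀ j, IsFiniteMeasure (ρ j)]
  {p : ∀ j, (∀ k : nbrs G.ES j, S k) →
    (∀ k : nbrs G.ES j, EuclideanSpace ℝ (Fin (m k))) → S j → ℝ}
  {π : ∀ j, DetPolicy (EuclideanSpace ℝ (Fin (d j))) (G.Obs j) (EuclideanSpace ℝ (Fin (m j)))}
  (θ : ∀ j, EuclideanSpace ℝ (Fin (d j))) (i : V)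

/-- The action spaces are not compact, but the joint action is a continuous function of the state
and of `ϑ`, which range over a compact space and a closed ball. The reward is therefore bounded on
the actions played. -/
theorem exists_reward_bound
    (hr : ∀ j, ContC1 (fun (s : ∀ k : nbrs G.ER j, S k)
      (a : ∀ k : nbrs G.ER j, EuclideanSpace ℝ (Fin (m k))) => G.r j (s, a)))
    (hπ : ∀ j, ContC1 (fun (o : G.Obs j) (ϑ : EuclideanSpace ℝ (Fin (d j))) => (π j).act ϑ o)) :
    ∃ B, ∀ ϑ ∈ Metric.ball (θ i) 1, ∀ j s,
      ∀ᵐ a ∂(G.globalPolicy (fun j => (π j).kernel (Function.update θ i ϑ j)) s),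
        |G.reward j (s, a)| ≤ B := by
  have hc : Continuous (fun (x : (∀ j, S j) × EuclideanSpace ℝ (Fin (d i))) (j : V) =>
      G.reward j (x.1, globalActUpdate π θ i x.1 x.2)) :=
    continuous_pi fun j => (contC1_reward hr j).1.comp
      (continuous_fst.prodMk (contC1_globalActUpdate θ i hπ).1)
  obtain ⟨B, hB⟩ := (isCompact_univ.prod
    (isCompact_closedBall (θ i) 1)).exists_bound_of_continuousOn hc.continuousOn
  refine ⟨B, fun ϑ hϑ j s => ?_⟩
  rw [globalPolicy_det_update, ae_dirac_eq]
  exact (norm_le_pi_norm _ j).trans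
    (hB (s, ϑ) ⟨Set.mem_univ _, Metric.ball_subset_closedBall hϑ⟩)

/-- One Bellman step: the critic is the reward plus the discounted integral of a value function
against the transition density. The given action enters only through the reward and the density, so
nothing about the smoothness of the value function is needed. -/
theorem contC1_Q
    (hp0 : ∀ j s a s', 0 ≤ p j s a s')
    (hP : ∀ j s a, G.P j (s, a) = (ρ j).withDensity (fun s' => ENNReal.ofReal (p j s a s')))
    (hpC : ∀ j, ContC1 (fun (x : (∀ k : nbrs G.ES j, S k) × S j)
      (a : ∀ k : nbrs G.ES j, EuclideanSpace ℝ (Fin (m k))) => p j x.1 a x.2))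
    (hr : ∀ j, ContC1 (fun (s : ∀ k : nbrs G.ER j, S k)
      (a : ∀ k : nbrs G.ER j, EuclideanSpace ℝ (Fin (m k))) => G.r j (s, a)))
    {κ : ∀ j, Kernel (G.Obs j) (EuclideanSpace ℝ (Fin (m j)))} [∀ j, IsMarkovKernel (κ j)]
    {B : ℝ} (hB : ∀ j s, ∀ᵐ a ∂(G.globalPolicy κ s), |G.reward j (s, a)| ≤ B) (j : V) :
    ContC1 (fun s a => G.Q κ j s a) := by
  have hR := G.measurable_reward j
  have heq : (fun s a => G.Q κ j s a) = fun s a => G.reward j (s, a) +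
      G.γ * ∫ s', ctrlValue G.transition (G.globalPolicy κ) G.γ (G.reward j) s' *
        globalDens p (s, s') a ∂(Measure.pi ρ) := by
    funext s a
    rw [Q_eq_discSum hB, discSum_ctrlStep_eq hR G.γ_nonneg G.γ_lt_one (hB j),
      integral_transition hp0 hP hpC]
  rw [heq]
  exact (contC1_reward hr j).add (((contC1_globalDens hpC).integral_mul
    (measurable_ctrlValue hR G.γ_nonneg G.γ_lt_one (hB j))
    (abs_ctrlValue_le hR G.γ_nonneg G.γ_lt_one (hB j))).const_mul G.γ)

/-- The default action is `0`, so that extending the actions is a linear map; for the states a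
continuous extension is enough. -/
theorem contC1_localCritic {κ : ∀ j, Kernel (G.Obs j) (EuclideanSpace ℝ (Fin (m j)))}
    [∀ j, IsMarkovKernel (κ j)] {j : V} (hQ : ContC1 (fun s a => G.Q κ j s a))
    (zs : ∀ k, S k) : ContC1 (G.localCritic κ zs 0 j) := by
  have h := hQ.comp_clm (continuous_extendBy (G.Iq j) zs)
    (extendCLM (Y := fun j => EuclideanSpace ℝ (Fin (m j))) (G.Iq j))
  simp only [extendCLM_apply] at h
  exact h

theorem contC1_truncCritic
    {q : ∀ j, (∀ k : G.Iq j, S k) → (∀ k : G.Iq j, EuclideanSpace ℝ (Fin (m k))) → ℝ}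
    (hq : ∀ j, ContC1 (q j)) : ContC1 (G.truncCritic q i) := by
  refine ContC1.finset_sum Finset.univ fun j => ?_
  exact (hq j).comp_clm (φ := fun s => Finset.restrict₂ (π := S) (G.Iq_subset_Iqhat j.2) s)
    (Finset.continuous_restrict₂ _)
    (restrict₂CLM (Y := fun j => EuclideanSpace ℝ (Fin (m j))) (G.Iq_subset_Iqhat j.2))

theorem continuous_obsLoc (j : G.Iqhat i) :
    Continuous (fun s : ∀ k : G.Iqhat i, S k => G.obsLoc j s) :=
  Finset.continuous_restrict₂ (G.Iobs_subset_Iqhat j)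

variable {q : ∀ j, (∀ k : G.Iq j, S k) → (∀ k : G.Iq j, EuclideanSpace ℝ (Fin (m k))) → ℝ}

theorem contC1_criticOfAction
    (hπ : ∀ j, ContC1 (fun (o : G.Obs j) (ϑ : EuclideanSpace ℝ (Fin (d j))) => (π j).act ϑ o))
    (hq : ∀ j, ContC1 (q j)) : ContC1 (G.criticOfAction π θ q i) := by
  have hc : Continuous (fun (s : ∀ k : G.Iqhat i, S k) (k : G.Iqhat i) =>
      (π k).act (θ k) (G.obsLoc k s)) :=
    continuous_pi fun k => continuous_act θ hπ k (continuous_obsLoc i k)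
  exact (contC1_truncCritic i hq).comp continuous_id (ContC1.update hc (G.me i))

theorem continuous_detIntegrand
    (hπ : ∀ j, ContC1 (fun (o : G.Obs j) (ϑ : EuclideanSpace ℝ (Fin (d j))) => (π j).act ϑ o))
    (hq : ∀ j, ContC1 (q j)) : Continuous (G.detIntegrand π θ q i) := by
  have ho := continuous_obsLoc (G := G) i (G.me i)
  have h1 : Continuous (fun s : ∀ k : G.Iqhat i, S k =>
      fderiv ℝ (fun ϑ => (π i).act ϑ (G.obsLoc (G.me i) s)) (θ i)) :=
    (hπ i).2.2.comp (ho.prodMk continuous_const)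
  have h2 : Continuous (fun s : ∀ k : G.Iqhat i, S k =>
      gradient (G.criticOfAction π θ q i s) (G.actionLoc π θ i s)) :=
    (InnerProductSpace.toDual ℝ (EuclideanSpace ℝ (Fin (m i)))).symm.continuous.comp
      ((contC1_criticOfAction θ i hπ hq).2.2.comp
        (continuous_id.prodMk (continuous_act θ hπ i ho)))
  exact (ContinuousLinearMap.adjoint.continuous.comp h1).clm_apply h2

/-- Chain rule: the derivative in `ϑ` is the inner product of the action gradient with the image of
the Jacobian, and the adjoint moves the Jacobian to the other side. -/
theorem hasGradientAt_criticOfAction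
    (hπ : ∀ j, ContC1 (fun (o : G.Obs j) (ϑ : EuclideanSpace ℝ (Fin (d j))) => (π j).act ϑ o))
    (hq : ∀ j, ContC1 (q j)) (s : ∀ k : G.Iqhat i, S k) :
    HasGradientAt (fun ϑ => G.criticOfAction π θ q i s ((π i).act ϑ (G.obsLoc (G.me i) s)))
      (G.detIntegrand π θ q i s) (θ i) := by
  have h1 := (hπ i).hasFDerivAt (G.obsLoc (G.me i) s) (θ i)
  have h2 := ((contC1_criticOfAction θ i hπ hq).2.1 s (G.actionLoc π θ i s)).hasGradientAt
  rw [hasGradientAt_iff_hasFDerivAt] at h2 ⊢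
  have h3 := HasFDerivAt.comp (θ i) (f := fun ϑ => (π i).act ϑ (G.obsLoc (G.me i) s)) h2 h1
  refine h3.congr_fderiv ?_
  ext x
  simp only [ContinuousLinearMap.comp_apply, InnerProductSpace.toDual_apply_apply, detIntegrand]
  rw [ContinuousLinearMap.adjoint_inner_left]

theorem truncCritic_globalActUpdate (s : ∀ j, S j) (ϑ : EuclideanSpace ℝ (Fin (d i))) :
    G.truncCritic q i ((G.Iqhat i).restrict s)
      ((G.Iqhat i).restrict (globalActUpdate π θ i s ϑ)) =
    G.criticOfAction π θ q i ((G.Iqhat i).restrict s)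
      ((π i).act ϑ (G.obsLoc (G.me i) ((G.Iqhat i).restrict s))) := by
  unfold criticOfAction
  congr 1
  funext k
  rcases eq_or_ne k (G.me i) with rfl | h
  · exact (Function.update_self i _ (globalAct π θ s)).trans
      (Function.update_self (G.me i) _ (fun k : G.Iqhat i =>
        (π k).act (θ k) (G.obsLoc k ((G.Iqhat i).restrict s)))).symm
  · have h' : (k : V) ≠ i := fun h0 => h (Subtype.ext h0)
    exact (Function.update_of_ne h' _ (globalAct π θ s)).trans
      (Function.update_of_ne h _ (fun k : G.Iqhat i =>
        (π k).act (θ k) (G.obsLoc k ((G.Iqhat i).restrict s)))).symm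

/-- The policy gradient theorem for deterministic policies. -/
theorem det_policy_gradient (D : Measure (∀ j, S j)) [IsProbabilityMeasure D]
    (hp0 : ∀ j s a s', 0 ≤ p j s a s')
    (hP : ∀ j s a, G.P j (s, a) = (ρ j).withDensity (fun s' => ENNReal.ofReal (p j s a s')))
    (hpC : ∀ j, ContC1 (fun (x : (∀ k : nbrs G.ES j, S k) × S j)
      (a : ∀ k : nbrs G.ES j, EuclideanSpace ℝ (Fin (m k))) => p j x.1 a x.2))
    (hr : ∀ j, ContC1 (fun (s : ∀ k : nbrs G.ER j, S k)
      (a : ∀ k : nbrs G.ER j, EuclideanSpace ℝ (Fin (m k))) => G.r j (s, a)))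
    (hπ : ∀ j, ContC1 (fun (o : G.Obs j) (ϑ : EuclideanSpace ℝ (Fin (d j))) =>
      (π j).act ϑ o)) :
    ∃ q, G.IsLocalCritic (fun j => (π j).kernel (θ j)) q ∧
      (∀ s, DifferentiableAt ℝ (G.criticOfAction π θ q i s) (G.actionLoc π θ i s)) ∧
      Integrable (G.detIntegrand π θ q i)
        (G.visitationLoc (fun j => (π j).kernel (θ j)) D i) ∧
      HasGradientAt
        (fun ϑ => G.expectedReturn (fun j => (π j).kernel (Function.update θ i ϑ j)) D)
        ((1 - G.γ)⁻¹ • ∫ s, G.detIntegrand π θ q i s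
          ∂(G.visitationLoc (fun j => (π j).kernel (θ j)) D i)) (θ i) := by
  have hself : Function.update θ i (θ i) = θ := Function.update_eq_self i θ
  obtain ⟨B, hB⟩ := exists_reward_bound θ i hr hπ
  have hBθ := hB (θ i) (Metric.mem_ball_self one_pos)
  simp only [hself] at hBθ
  obtain ⟨zs⟩ : Nonempty (∀ j, S j) := nonempty_of_isProbabilityMeasure D
  have hQ := contC1_Q hp0 hP hpC hr hBθ
  obtain ⟨q, hqloc, hq⟩ : ∃ q, G.IsLocalCritic (fun j => (π j).kernel (θ j)) q ∧
      ∀ j, ContC1 (q j) :=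
    ⟨_, isLocalCritic_localCritic hBθ zs 0, fun j => contC1_localCritic (hQ j) zs⟩
  have hcont := continuous_detIntegrand θ i hπ hq
  obtain ⟨C, hC⟩ := isCompact_univ.exists_bound_of_continuousOn hcont.continuousOn
  refine ⟨q, hqloc, fun s => (contC1_criticOfAction θ i hπ hq).2.1 s _,
    Integrable.of_bound hcont.aestronglyMeasurable C (.of_forall fun s => hC s (Set.mem_univ s)),
    ?_⟩
  have hact := contC1_globalActUpdate θ i hπ
  have hRC : ContC1 (fun (s : ∀ j, S j) (a : ∀ j, EuclideanSpace ℝ (Fin (m j))) =>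
      G.totalReward (s, a)) := ContC1.finset_sum Finset.univ (contC1_reward hr)
  obtain ⟨L₁, hL₁, hlip₁⟩ := (hRC.comp continuous_id hact).exists_lipschitz (θ i)
  obtain ⟨L₂, hL₂, hlip₂⟩ := ((contC1_globalDens hpC).comp (continuous_id)
    (hact.comp_clm continuous_fst (ContinuousLinearMap.id ℝ _))).exists_lipschitz (θ i)
  have hdensC : ∀ s a, Continuous (fun s' => globalDens p (s, s') a) := fun s a =>
    (contC1_globalDens hpC).1.comp (by fun_prop : Continuous (fun s' => ((s, s'), a)))
  -- `L₁` is the Lipschitz constant of the total reward along the played actions. `L₂` is that of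
  -- the transition density, uniform in both states, and integrating over the next state costs the
  -- mass of the reference measure.
  have key := hasGradientAt_expectedReturn (B := B)
    (L := max L₁ (L₂ * (Measure.pi ρ).real Set.univ))
    (fun ϑ j => (π j).kernel (Function.update θ i ϑ j)) (θ i) D one_pos hB ?_ ?_
    (g := fun s => G.detIntegrand π θ q i ((G.Iqhat i).restrict s)) ?_ ?_
  · simp only [hself] at key
    rw [visitationLoc, integral_map (by fun_prop) hcont.aestronglyMeasurable]
    exact key.2
  · intro ϑ hϑ s
    simp only [globalPolicy_det_update, integral_dirac]
    refine (hlip₁ s ϑ hϑ).trans ?_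
    gcongr
    exact le_max_left _ _
  · intro w hw M hM ϑ hϑ s
    have hM0 : 0 ≤ M := (abs_nonneg _).trans (hM s)
    have hint : ∀ a, Integrable (fun s' => w s' * globalDens p (s, s') a) (Measure.pi ρ) := by
      intro a
      obtain ⟨K, hK⟩ := isCompact_univ.exists_bound_of_continuousOn (hdensC s a).continuousOn
      exact (Integrable.of_bound (hdensC s a).aestronglyMeasurable K
        (.of_forall fun s' => hK s' (Set.mem_univ s'))).bdd_mul (c := M)
        hw.aestronglyMeasurable (.of_forall hM)
    simp only [globalPolicy_det_update, integral_dirac]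
    rw [integral_transition hp0 hP hpC, integral_transition hp0 hP hpC,
      ← integral_sub (hint _) (hint _)]
    refine (norm_integral_le_of_norm_le_const (μ := Measure.pi ρ) (C := M * (L₂ * ‖ϑ - θ i‖))
      (f := fun s' => w s' * globalDens p (s, s') (globalActUpdate π θ i s ϑ) -
        w s' * globalDens p (s, s') (globalActUpdate π θ i s (θ i))) (.of_forall fun s' => ?_)).trans ?_
    · rw [← mul_sub, norm_mul]
      exact mul_le_mul (hM s') (hlip₂ (s, s') ϑ hϑ) (norm_nonneg _) hM0
    · rw [show M * (L₂ * ‖ϑ - θ i‖) * (Measure.pi ρ).real Set.univ =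
        (L₂ * (Measure.pi ρ).real Set.univ) * M * ‖ϑ - θ i‖ by ring]
      gcongr
      exact le_max_right _ _
  · exact (hcont.comp (by fun_prop : Continuous
      (fun s : ∀ j, S j => (G.Iqhat i).restrict s))).aestronglyMeasurable
  · intro s
    simp only [hself, globalPolicy_det_update, integral_dirac]
    -- The critics outside `Igd i` may be evaluated at the unperturbed joint action, so they form a
    -- constant in `ϑ`.
    have h := (hasGradientAt_criticOfAction θ i hπ hq ((G.Iqhat i).restrict s)).add_const_right
      (∑ j ∈ (G.Igd i)ᶜ, G.Q (fun j => (π j).kernel (θ j)) j s (globalAct π θ s))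
    convert h using 2 with ϑ
    rw [← truncCritic_globalActUpdate]
    exact sum_Q_update hBθ hqloc i s _ _

end DetGradient

end Game

end MARL

end

theorem theorem3 {V : Type*} [Fintype V] [DecidableEq V] (d : V → ℕ)
    (θ : ∀ j, EuclideanSpace ℝ (Fin (d j))) (i : V) :
    -- (a) deterministic policies
    (∀ {S : V → Type*} [∀ j, MetricSpace (S j)] [∀ j, CompactSpace (S j)]
        [∀ j, MeasurableSpace (S j)] [∀ j, BorelSpace (S j)] (m : V → ℕ)
        (G : MARL.Game V S (fun j => EuclideanSpace ℝ (Fin (m j))))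
        (D : Measure (∀ j, S j)) [IsProbabilityMeasure D]
        (ρ : ∀ j, Measure (S j)) [∀ j, IsFiniteMeasure (ρ j)]
        (p : ∀ j, (∀ k : MARL.nbrs G.ES j, S k) →
          (∀ k : MARL.nbrs G.ES j, EuclideanSpace ℝ (Fin (m k))) → S j → ℝ)
        (_ : ∀ j s a s', 0 ≤ p j s a s')
        (_ : ∀ j s a, G.P j (s, a) = (ρ j).withDensity (fun s' => ENNReal.ofReal (p j s a s')))
        (_ : ∀ j, MARL.ContC1 (fun (x : (∀ k : MARL.nbrs G.ES j, S k) × S j)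
          (a : ∀ k : MARL.nbrs G.ES j, EuclideanSpace ℝ (Fin (m k))) => p j x.1 a x.2))
        (_ : ∀ j, MARL.ContC1 (fun (s : ∀ k : MARL.nbrs G.ER j, S k)
          (a : ∀ k : MARL.nbrs G.ER j, EuclideanSpace ℝ (Fin (m k))) => G.r j (s, a)))
        (π : ∀ j, MARL.DetPolicy (EuclideanSpace ℝ (Fin (d j))) (G.Obs j)
          (EuclideanSpace ℝ (Fin (m j))))
        (_ : ∀ j, MARL.ContC1 (fun (o : G.Obs j) (ϑ : EuclideanSpace ℝ (Fin (d j))) =>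
          (π j).act ϑ o)),
      ∃ q, G.IsLocalCritic (fun j => (π j).kernel (θ j)) q ∧
        (∀ s, DifferentiableAt ℝ (G.criticOfAction π θ q i s) (G.actionLoc π θ i s)) ∧
        Integrable (G.detIntegrand π θ q i)
          (G.visitationLoc (fun j => (π j).kernel (θ j)) D i) ∧
        HasGradientAt
          (fun ϑ => G.expectedReturn (fun j => (π j).kernel (Function.update θ i ϑ j)) D)
          ((1 - G.γ)⁻¹ • ∫ s, G.detIntegrand π θ q i s
            ∂(G.visitationLoc (fun j => (π j).kernel (θ j)) D i))
          (θ i)) ∧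
    -- (b) stochastic policies
    (∀ {S A : V → Type*} [∀ j, MeasurableSpace (S j)] [∀ j, MeasurableSpace (A j)]
        (G : MARL.Game V S A) (D : Measure (∀ j, S j)) [IsProbabilityMeasure D]
        (ν : ∀ j, Measure (A j)) [∀ j, SigmaFinite (ν j)]
        (π : ∀ j, MARL.StochPolicy (EuclideanSpace ℝ (Fin (d j))) (G.Obs j) (A j) (ν j))
        (_ : ∃ R : ℝ, ∀ j x, |G.r j x| ≤ R)
        (_ : (π i).RegularAt (θ i)),
      ∃ q, G.IsLocalCritic (fun j => (π j).kernel (θ j)) q ∧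
        Integrable (G.stochIntegrand π θ q i)
          (G.visitationLoc (fun j => (π j).kernel (θ j)) D i ⊗ₘ
            G.policyLoc (fun j => (π j).kernel (θ j)) i) ∧
        HasGradientAt
          (fun ϑ => G.expectedReturn (fun j => (π j).kernel (Function.update θ i ϑ j)) D)
          ((1 - G.γ)⁻¹ • ∫ x, G.stochIntegrand π θ q i x
            ∂(G.visitationLoc (fun j => (π j).kernel (θ j)) D i ⊗ₘ
            G.policyLoc (fun j => (π j).kernel (θ j)) i)) (θ i)) := by
  refine ⟨?_, ?_⟩
  · intro S _ _ _ _ m G D _ ρ _ p hp0 hP hpC hr π hπ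
    exact MARL.Game.det_policy_gradient θ i D hp0 hP hpC hr hπ
  · intro S A _ _ G D _ ν _ π hr hp
    exact MARL.Game.stoch_policy_gradient D hr hp
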